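/- Let $C,D\in\mathbb R^{d\times d}$ be such that - $D$ is positive semi-definite with $\operatorname{rank}D=r\ge 1$; - every (complex) eigenvalue of $C$ has positive real part; - $\ker D$ contains no non-zero $C^T$-invariant subspace; - $D=\operatorname{diag}(d_1,\dots,d_r,0,\dots,0)=\tfrac12(C+C^T)$. Let $f_\infty(x)=(2\pi)^{-d/2}e^{-|x|^2/2}$, let $L^2(f_\infty^{-1})$ be the real Hilbert space $L^2(\mathbb R^d,f_\infty(x)^{-1}dx)$ and, for a multi-index $\alpha\in\mathbb N_0^d$ with $|\alpha|=\sum_i\alpha_i$ and $\alpha!=\prod_i\alpha_i!$, let $h_\alpha=(-1)^{|\alpha|}\partial^\alpha f_\infty$ be the Hermite functions; put $V_k=\operatorname{span}\{h_\alpha:|\alpha|=k\}\subset L^2(f_\infty^{-1})$. Let $m\in\mathbb N_0$, let $f_0\in L^2(f_\infty^{-1})$ be orthogonal to $V_0,\dots,V_{m-1}$, and let $f$ be the solution of the normalised Fokker–Planck equation $$\partial_t f=\operatorname{div}(D\nabla f+Cxf)=\operatorname{div}\Big(f_\infty C\nabla\frac{f}{f_\infty}\Big),\qquad t>0,\qquad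 f(0)=f_0,$$ that is, $f\in C([0,\infty);L^2(f_\infty^{-1}))$, $f(0)=f_0$, and for every $\varphi\in C_c^\infty(\mathbb R^d)$ and every $t>0$ $$\frac{d}{dt}\int_{\mathbb R^d} f(t)\,\varphi\,dx=\int_{\mathbb R^d} f(t)\,\big(\operatorname{div}(D\nabla\varphi)-Cx\cdot\nabla\varphi\big)\,dx .$$ Let $d_\alpha(t)=\frac1{\alpha!}\langle f(t),h_\alpha\rangle_{L^2(f_\infty^{-1})}$. Then for every $t>0$ one has $f(t)=\sum_{k=0}^\infty\sum_{|\alpha|=k}d_\alpha(t)h_\alpha$ in $L^2(f_\infty^{-1})$, and the Fisher information $$I_2(f(t)|f_\infty)=\int_{\mathbb R^d}\Big|\nabla\frac{f(x,t)}{f_\infty(x)}\Big|^2f_\infty(x)\,dx$$ (with $\nabla$ the weak gradient, which is the classical one where $f(t)$ is smooth) is finite and equals $$I_2(f(t)|f_\infty)=\sum_{k=m}^\infty k\sum_{|\alpha|=k}\alpha!\,d_\alpha(t)^2 .$$ -/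

import Mathlib

open MeasureTheory Set Filter
open scoped ENNReal ContDiff

noncomputable section

namespace FokkerPlanck

/-- The Euclidean space `ℝᵈ`. -/
abbrev Space (d : ℕ) : Type := EuclideanSpace ℝ (Fin d)

/-- The standard Gaussian `f_∞(x) = (2π)^(-d/2) exp(-|x|²/2)`. -/
def gaussian (d : ℕ) (x : Space d) : ℝ :=
  ((2 * Real.pi) ^ ((d : ℝ) / 2))⁻¹ * Real.exp (-‖x‖ ^ 2 / 2)

/-- The measure `f_∞(x)⁻¹ dx` on `ℝᵈ`. -/
def invGaussianMeasure (d : ℕ) : Measure (Space d) :=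
  (volume : Measure (Space d)).withDensity fun x => ENNReal.ofReal (gaussian d x)⁻¹

/-- The real Hilbert space `L²(ℝᵈ, f_∞⁻¹)`. -/
abbrev WeightedL2 (d : ℕ) : Type := Lp ℝ 2 (invGaussianMeasure d)

/-- The partial derivative `∂u/∂xᵢ`. -/
def partialDeriv {d : ℕ} (i : Fin d) (u : Space d → ℝ) (x : Space d) : ℝ :=
  fderiv ℝ u x (EuclideanSpace.single i 1)

/-- The iterated partial derivative `∂^α = ∂₁^(α₁) ⋯ ∂_d^(α_d)`. -/
def multiDeriv {d : ℕ} (α : Fin d → ℕ) (u : Space d → ℝ) : Space d → ℝ :=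
  (List.finRange d).foldr (fun i v => (partialDeriv i)^[α i] v) u

/-- The order `|α|` of a multi-index. -/
def order {d : ℕ} (α : Fin d → ℕ) : ℕ := ∑ i, α i

/-- The factorial `α! = ∏ αᵢ!` of a multi-index. -/
def multiFactorial {d : ℕ} (α : Fin d → ℕ) : ℕ := ∏ i, (α i).factorial

/-- The Hermite function `h_α = (-1)^|α| ∂^α f_∞`. -/
def hermiteFun {d : ℕ} (α : Fin d → ℕ) (x : Space d) : ℝ :=
  (-1) ^ order α * multiDeriv α (gaussian d) x

/-! Helper facts: the Hermite functions belong to `L²(ℝᵈ, f_∞⁻¹)`. -/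

theorem gaussian_pos (d : ℕ) (x : Space d) : 0 < gaussian d x := by
  unfold gaussian; positivity

theorem continuous_gaussian (d : ℕ) : Continuous (gaussian d) := by
  unfold gaussian; fun_prop

theorem hasFDerivAt_gaussian (d : ℕ) (x : Space d) :
    HasFDerivAt (gaussian d) (-(gaussian d x) • innerSL ℝ x) x := by
  have h1 : HasFDerivAt (fun y : Space d => -‖y‖ ^ 2 / 2) (-(innerSL ℝ x)) x := by
    have h := ((hasStrictFDerivAt_norm_sq x).hasFDerivAt).const_mul (-(1 / 2 : ℝ))
    have e : (fun y : Space d => -‖y‖ ^ 2 / 2) = fun y => -(1 / 2 : ℝ) * ‖y‖ ^ 2 := by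
      funext y; ring
    rw [e]
    refine h.congr_fderiv ?_
    ext v
    simp
  have h2 := (h1.exp).const_mul (((2 * Real.pi) ^ ((d : ℝ) / 2))⁻¹)
  refine h2.congr_fderiv ?_
  ext v
  simp [gaussian]
  ring

theorem hasFDerivAt_eval {d : ℕ} (p : MvPolynomial (Fin d) ℝ) (x : Space d) :
    ∃ A : Space d →L[ℝ] ℝ, HasFDerivAt (fun y : Space d => MvPolynomial.eval y.ofLp p) A x ∧
      ∀ i, A (EuclideanSpace.single i 1) = MvPolynomial.eval x.ofLp (MvPolynomial.pderiv i p) := by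
  induction p using MvPolynomial.induction_on with
  | C a => exact ⟨0, by simpa using hasFDerivAt_const a x, by simp⟩
  | add p q hp hq =>
    obtain ⟨A, hA, hA'⟩ := hp
    obtain ⟨B, hB, hB'⟩ := hq
    refine ⟨A + B, ?_, fun i => by simp [hA', hB']⟩
    simp only [map_add]
    exact hA.add hB
  | mul_X p j hp =>
    obtain ⟨A, hA, hA'⟩ := hp
    have hX : HasFDerivAt (fun y : Space d => y.ofLp j)
        (EuclideanSpace.proj j : Space d →L[ℝ] ℝ) x :=
      (EuclideanSpace.proj j : Space d →L[ℝ] ℝ).hasFDerivAt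
    refine ⟨MvPolynomial.eval x.ofLp p • (EuclideanSpace.proj j : Space d →L[ℝ] ℝ)
      + x.ofLp j • A, ?_, fun i => ?_⟩
    · simp only [map_mul, MvPolynomial.eval_X]
      exact hA.mul hX
    by_cases h : j = i
    · subst h
      simp [hA']
    · simp [hA', MvPolynomial.pderiv_X_of_ne h, h]

theorem partialDeriv_mul_gaussian {d : ℕ} (p : MvPolynomial (Fin d) ℝ) (i : Fin d) :
    partialDeriv i (fun x => MvPolynomial.eval x.ofLp p * gaussian d x) = fun x =>
      MvPolynomial.eval x.ofLp (MvPolynomial.pderiv i p - MvPolynomial.X i * p)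
        * gaussian d x := by
  funext x
  obtain ⟨A, hA, hA'⟩ := hasFDerivAt_eval p x
  have h := (hA.mul (hasFDerivAt_gaussian d x)).fderiv
  unfold partialDeriv
  change fderiv ℝ ((fun y : Space d => MvPolynomial.eval y.ofLp p) * gaussian d) x _ = _
  rw [h]
  simp [hA', EuclideanSpace.inner_single_right]
  ring

/-- `h_α` is a polynomial times `f_∞`. -/
theorem hermiteFun_eq_polynomial {d : ℕ} (α : Fin d → ℕ) :
    ∃ p : MvPolynomial (Fin d) ℝ,
      hermiteFun α = fun x => MvPolynomial.eval x.ofLp p * gaussian d x := by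
  have key : ∀ l : List (Fin d), ∃ p : MvPolynomial (Fin d) ℝ,
      l.foldr (fun i v => (partialDeriv i)^[α i] v) (gaussian d)
        = fun x => MvPolynomial.eval x.ofLp p * gaussian d x := by
    intro l
    induction l with
    | nil => exact ⟨1, by simp⟩
    | cons i l ih =>
      obtain ⟨p, hp⟩ := ih
      rw [List.foldr_cons, hp]
      generalize α i = n
      induction n generalizing p with
      | zero => exact ⟨p, rfl⟩
      | succ n ihn =>
        rw [Function.iterate_succ_apply, partialDeriv_mul_gaussian]
        clear hp
        have : ∀ n : ℕ, ∀ q : MvPolynomial (Fin d) ℝ, ∃ r : MvPolynomial (Fin d) ℝ,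
            (partialDeriv i)^[n] (fun x => MvPolynomial.eval x.ofLp q * gaussian d x)
              = fun x => MvPolynomial.eval x.ofLp r * gaussian d x := by
          intro n
          induction n with
          | zero => exact fun q => ⟨q, rfl⟩
          | succ n ih =>
            intro q
            rw [Function.iterate_succ_apply, partialDeriv_mul_gaussian]
            exact ih _
        exact this n _
  obtain ⟨p, hp⟩ := key (List.finRange d)
  refine ⟨MvPolynomial.C ((-1) ^ order α) * p, ?_⟩
  funext x
  unfold hermiteFun multiDeriv
  rw [hp]
  simp [mul_assoc]

theorem continuous_eval {d : ℕ} (p : MvPolynomial (Fin d) ℝ) :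
    Continuous fun x : Space d => MvPolynomial.eval x.ofLp p :=
  (MvPolynomial.continuous_eval p).comp (PiLp.continuous_ofLp 2 _)

theorem abs_eval_le {d : ℕ} (p : MvPolynomial (Fin d) ℝ) :
    ∃ A : ℝ, ∃ N : ℕ, 0 ≤ A ∧
      ∀ x : Space d, |MvPolynomial.eval x.ofLp p| ≤ A * (1 + ‖x‖) ^ N := by
  induction p using MvPolynomial.induction_on with
  | C a => exact ⟨|a|, 0, abs_nonneg a, by simp⟩
  | add p q hp hq =>
    obtain ⟨A, N, hA, h⟩ := hp
    obtain ⟨B, M, hB, h'⟩ := hq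
    refine ⟨A + B, N + M, by positivity, fun x => ?_⟩
    have h1 : (1 : ℝ) ≤ 1 + ‖x‖ := by linarith [norm_nonneg x]
    have e1 : (1 + ‖x‖) ^ N ≤ (1 + ‖x‖) ^ (N + M) := pow_le_pow_right₀ h1 (by omega)
    have e2 : (1 + ‖x‖) ^ M ≤ (1 + ‖x‖) ^ (N + M) := pow_le_pow_right₀ h1 (by omega)
    rw [map_add, add_mul]
    refine (abs_add_le _ _).trans (add_le_add ((h x).trans ?_) ((h' x).trans ?_))
    · gcongr
    · gcongr
  | mul_X p j hp =>
    obtain ⟨A, N, hA, h⟩ := hp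
    refine ⟨A, N + 1, hA, fun x => ?_⟩
    have hj : |x.ofLp j| ≤ 1 + ‖x‖ := by
      have := PiLp.norm_apply_le x j
      rw [Real.norm_eq_abs] at this
      linarith
    rw [map_mul, abs_mul, MvPolynomial.eval_X, pow_succ, ← mul_assoc]
    exact mul_le_mul (h x) hj (abs_nonneg _) (by positivity)

theorem integrable_eval_mul_gaussian {d : ℕ} (p : MvPolynomial (Fin d) ℝ) :
    Integrable fun x : Space d => MvPolynomial.eval x.ofLp p * gaussian d x := by
  obtain ⟨A, N, hA, h⟩ := abs_eval_le p
  have hexp : Integrable fun x : Space d => Real.exp (-(1 / 4) * ‖x‖ ^ 2) := by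
    have h0 := GaussianFourier.integrable_cexp_neg_mul_sq_norm_add (V := Space d)
      (b := (1 / 4 : ℂ)) (by norm_num) 0 0
    refine h0.norm.congr (Eventually.of_forall fun x => ?_)
    simp only [Complex.norm_exp]
    congr 1
    have : (-(1 / 4 : ℂ) * (‖x‖ : ℂ) ^ 2) = ((-(1 / 4) * ‖x‖ ^ 2 : ℝ) : ℂ) := by push_cast; ring
    simp only [zero_mul, add_zero, this, Complex.ofReal_re]
  refine (hexp.const_mul
    (A * N.factorial * ((2 * Real.pi) ^ ((d : ℝ) / 2))⁻¹ * Real.exp 2)).mono'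
    ((continuous_eval p).mul (continuous_gaussian d)).aestronglyMeasurable
    (Eventually.of_forall fun x => ?_)
  have hf : (1 + ‖x‖) ^ N ≤ N.factorial * Real.exp (1 + ‖x‖) := by
    have := Real.pow_div_factorial_le_exp (1 + ‖x‖) (by positivity) N
    rw [div_le_iff₀ (by positivity)] at this
    linarith
  have he : Real.exp (1 + ‖x‖) * Real.exp (-‖x‖ ^ 2 / 2)
      ≤ Real.exp 2 * Real.exp (-(1 / 4) * ‖x‖ ^ 2) := by
    rw [← Real.exp_add, ← Real.exp_add]
    exact Real.exp_le_exp.2 (by nlinarith [sq_nonneg (‖x‖ - 2)])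
  rw [norm_mul, Real.norm_eq_abs, Real.norm_of_nonneg (gaussian_pos d x).le]
  unfold gaussian
  set c := ((2 * Real.pi) ^ ((d : ℝ) / 2))⁻¹ with hc
  have hc0 : 0 ≤ c := by positivity
  calc |MvPolynomial.eval x.ofLp p| * (c * Real.exp (-‖x‖ ^ 2 / 2))
      ≤ (A * (N.factorial * Real.exp (1 + ‖x‖))) * (c * Real.exp (-‖x‖ ^ 2 / 2)) := by
        refine mul_le_mul_of_nonneg_right ((h x).trans ?_) (by positivity)
        gcongr
    _ = A * N.factorial * c * (Real.exp (1 + ‖x‖) * Real.exp (-‖x‖ ^ 2 / 2)) := by ring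
    _ ≤ A * N.factorial * c * (Real.exp 2 * Real.exp (-(1 / 4) * ‖x‖ ^ 2)) := by gcongr
    _ = _ := by ring

theorem memLp_hermiteFun {d : ℕ} (α : Fin d → ℕ) :
    MemLp (hermiteFun α) 2 (invGaussianMeasure d) := by
  obtain ⟨p, hp⟩ := hermiteFun_eq_polynomial α
  rw [hp]
  have hcont : Continuous fun x : Space d => MvPolynomial.eval x.ofLp p * gaussian d x :=
    (continuous_eval p).mul (continuous_gaussian d)
  rw [memLp_two_iff_integrable_sq hcont.aestronglyMeasurable]
  unfold invGaussianMeasure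
  rw [integrable_withDensity_iff (by
    exact (continuous_gaussian d).measurable.inv.ennreal_ofReal) (by simp)]
  refine (integrable_eval_mul_gaussian (p * p)).congr (Eventually.of_forall fun x => ?_)
  have h0 := gaussian_pos d x
  simp only [map_mul]
  rw [ENNReal.toReal_ofReal (by positivity)]
  field_simp

/-- The Hermite function `h_α` as a vector of `L²(ℝᵈ, f_∞⁻¹)`. -/
def hermite {d : ℕ} (α : Fin d → ℕ) : WeightedL2 d := (memLp_hermiteFun α).toLp (hermiteFun α)

/-- `V_k`, the span of the Hermite functions of order `k`. -/
def hermiteSpace (d k : ℕ) : Submodule ℝ (WeightedL2 d) :=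
  Submodule.span ℝ {v | ∃ α : Fin d → ℕ, order α = k ∧ v = hermite α}

/-- The Hermite coefficient `d_α = ⟨f, h_α⟩ / α!` of `f ∈ L²(ℝᵈ, f_∞⁻¹)`. -/
def hermiteCoeff {d : ℕ} (f : WeightedL2 d) (α : Fin d → ℕ) : ℝ :=
  inner ℝ f (hermite α) / multiFactorial α

/-- The (finite) set of multi-indices of order `k`. -/
def multiIndices (d k : ℕ) : Finset (Fin d → ℕ) := Finset.univ.piAntidiag k

theorem mem_multiIndices {d k : ℕ} {α : Fin d → ℕ} : α ∈ multiIndices d k ↔ order α = k := by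
  simp [multiIndices, order, Finset.mem_piAntidiag]

/-- The standing assumptions on the drift matrix `C` and the diffusion matrix `D` of the
normalised Fokker-Planck equation. -/
structure IsNormalised {d : ℕ} (C D : Matrix (Fin d) (Fin d) ℝ) : Prop where
  /-- `D` is positive semi-definite. -/
  posSemidef : D.PosSemidef
  /-- `rank D ≥ 1`. -/
  one_le_rank : 1 ≤ D.rank
  /-- Every (complex) eigenvalue of `C` has positive real part. -/
  positive_stable : ∀ z : ℂ,
    Module.End.HasEigenvalue (Matrix.toLin' (C.map (algebraMap ℝ ℂ))) z → 0 < z.re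
  /-- There is no nontrivial `Cᵀ`-invariant subspace of `ker D`. -/
  no_invariant_subspace : ∀ W : Submodule ℝ (Fin d → ℝ),
    (∀ v ∈ W, D.mulVec v = 0) → (∀ v ∈ W, C.transpose.mulVec v ∈ W) → W = ⊥
  /-- `D = diag(d₁, …, d_r, 0, …, 0)` with `r = rank D`. -/
  diagonal : ∃ δ : Fin d → ℝ, D = Matrix.diagonal δ ∧ ∀ i : Fin d, D.rank ≤ (i : ℕ) → δ i = 0
  /-- `D` is the symmetric part of `C`. -/
  eq_symmetric_part : D = (1 / 2 : ℝ) • (C + C.transpose)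

/-- Test functions: `C_c^∞(ℝᵈ)`. -/
def IsTestFunction {d : ℕ} (φ : Space d → ℝ) : Prop := ContDiff ℝ ∞ φ ∧ HasCompactSupport φ

/-- The formal `L²(dx)`-adjoint of the Fokker-Planck operator `f ↦ div(D∇f + C x f)`:
`φ ↦ div(D∇φ) - (C x) · ∇φ` (for symmetric `D`). -/
def dualOperator {d : ℕ} (C D : Matrix (Fin d) (Fin d) ℝ) (φ : Space d → ℝ) (x : Space d) : ℝ :=
  ∑ i, ∑ j, D i j * partialDeriv i (partialDeriv j φ) x
    - ∑ i, (∑ j, C i j * x j) * partialDeriv i φ x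

/-- `f` is a solution of `∂ₜf = div(D∇f + C x f)`, `f(0) = f₀`: a continuous curve
`[0,∞) → L²(ℝᵈ, f_∞⁻¹)` that starts at `f₀` and satisfies the equation for `t > 0` in the sense of
distributions, `d/dt ∫ f(t) φ dx = ∫ f(t) (div(D∇φ) - (C x) · ∇φ) dx` for all test functions. -/
structure IsSolution {d : ℕ} (C D : Matrix (Fin d) (Fin d) ℝ) (f₀ : WeightedL2 d)
    (f : ℝ → WeightedL2 d) : Prop where
  continuousOn : ContinuousOn f (Ici 0)
  initial : f 0 = f₀
  equation : ∀ φ : Space d → ℝ, IsTestFunction φ → ∀ t : ℝ, 0 < t →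
    HasDerivAt (fun s => ∫ x, f s x * φ x) (∫ x, f t x * dualOperator C D φ x) t

/-- `g` is the weak gradient of `u` on `ℝᵈ`. -/
structure IsWeakGradient {d : ℕ} (u : Space d → ℝ) (g : Space d → Space d) : Prop where
  locallyIntegrable : LocallyIntegrable u
  locallyIntegrable_grad : LocallyIntegrable g
  integral_eq : ∀ φ : Space d → ℝ, IsTestFunction φ → ∀ i : Fin d,
    ∫ x, u x * partialDeriv i φ x = -∫ x, g x i * φ x

/-- The Fisher information `I₂(f | f_∞) = ∫ |∇(f/f_∞)|² f_∞ dx ∈ [0,∞]`, where `∇` is the weak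
gradient. The weak gradient is unique up to null sets, so the infimum runs over at most one value;
it is `∞` if `f/f_∞` has no weak gradient. -/
def fisherInformation {d : ℕ} (f : Space d → ℝ) : ℝ≥0∞ :=
  ⨅ (g : Space d → Space d) (_ : IsWeakGradient (fun x => f x / gaussian d x) g),
    ∫⁻ x, ‖g x‖ₑ ^ 2 * ENNReal.ofReal (gaussian d x)

end FokkerPlanck

end

/-!
The Hermite functions `h_α` diagonalise the Fisher information, so the formula is Parseval's
identity for the gradient; what has to be proved is that the series is finite at every positive
time, although the diffusion matrix `D` may be degenerate.

**Hermite expansion.** Writing `h_α = H_α f_∞`, the polynomials `H_α` arise from `1` by the creation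
operators `a_i† = x_i - ∂_i`, the adjoints of `∂_i` for the Gaussian measure. The commutation
relation gives `∂_i H_α = α_i H_{α - e_i}` and `⟨h_α, h_β⟩ = α! δ_{αβ}`. The `h_α` are complete, as
a function orthogonal to all polynomials has vanishing Fourier transform (`hermiteBasis`).

**Fisher information.** If `∑ |α| α! d_α² < ∞`, the weak partial derivatives of `f / f_∞` are
`∑ d_α α_i H_{α - e_i}`; their weighted norms add up to `∑ |α| α! d_α²`, and weak gradients are
unique (`fisherInformation_eq_tsum`).

**The equation on `V_k`.** A cutoff argument admits polynomials as test functions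
(`IsSolution.hasDerivAt_integral_mul_eval`). On them the dual operator is
`-∑ C_ij a_j† ∂_i`, because `D` is the symmetric part of `C`. Hence, for tuples
`I ∈ {1, …, d}^k` and the multi-index `α(I)` counting their entries, the tensor
`T_I(t) = ⟨f(t), h_{α(I)}⟩` solves `T' = -∑_r C^(r) T` with `C` acting on each slot, and `T(t)` is
the `k`-fold tensor power of `exp (-tC)` applied to `T(0)`. Since
`∑_I T_I² = k! ∑_{|α| = k} α! d_α²`, the component in `V_k` decays by the factor `‖exp (-tC)‖ ^ k`
(`IsSolution.sum_hermiteCoeff_sq_le`). In particular components that vanish initially stay zero.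

**Strict contraction.** `d/dt |exp (-tC) v|² = -2 ⟨D y, y⟩ ≤ 0` for `y = exp (-tC) v`, and equality
on an interval puts `v` into a `Cᵀ`-invariant subspace of `ker D`. Therefore `‖exp (-tC)‖ < 1` for
`t > 0` (`norm_driftFlow_lt_one`), and `∑ k ‖exp (-tC)‖ ^ (2k)` converges.
-/

noncomputable section

namespace FokkerPlanck

/-! ### Hermite polynomials -/

/-- The creation operator `p ↦ xᵢ p - ∂ᵢ p`, so that `∂ᵢ (p f_∞) = -(creation i p) f_∞`. It is the
adjoint of `∂ᵢ` with respect to the Gaussian measure. -/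
def creation {d : ℕ} (i : Fin d) : Module.End ℝ (MvPolynomial (Fin d) ℝ) :=
  LinearMap.mulLeft ℝ (MvPolynomial.X i) - (MvPolynomial.pderiv (R := ℝ) i).toLinearMap

theorem creation_apply {d : ℕ} (i : Fin d) (p : MvPolynomial (Fin d) ℝ) :
    creation i p = MvPolynomial.X i * p - MvPolynomial.pderiv i p := rfl

theorem pderiv_pderiv_comm {d : ℕ} (i j : Fin d) (p : MvPolynomial (Fin d) ℝ) :
    MvPolynomial.pderiv i (MvPolynomial.pderiv j p)
      = MvPolynomial.pderiv j (MvPolynomial.pderiv i p) := by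
  have h : ⁅MvPolynomial.pderiv (R := ℝ) i, MvPolynomial.pderiv (R := ℝ) j⁆ = 0 := by
    refine MvPolynomial.derivation_ext fun k => ?_
    simp only [Derivation.commutator_apply, MvPolynomial.pderiv_X, Pi.single_apply]
    split_ifs <;> simp
  have := DFunLike.congr_fun h p
  rwa [Derivation.commutator_apply, Derivation.zero_apply, sub_eq_zero] at this

/-- The canonical commutation relation between annihilation and creation operators. -/
theorem pderiv_creation {d : ℕ} (i j : Fin d) (p : MvPolynomial (Fin d) ℝ) :
    MvPolynomial.pderiv i (creation j p)
      = creation j (MvPolynomial.pderiv i p) + if i = j then p else 0 := by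
  rw [creation_apply, creation_apply, map_sub, Derivation.leibniz, pderiv_pderiv_comm]
  by_cases h : i = j
  · subst h
    simp only [smul_eq_mul, MvPolynomial.pderiv_X_self, mul_one, if_true]
    ring
  · simp only [smul_eq_mul, MvPolynomial.pderiv_X_of_ne (Ne.symm h), mul_zero, add_zero, h,
      if_false]

theorem commute_creation {d : ℕ} (i j : Fin d) : Commute (creation i) (creation j) := by
  refine LinearMap.ext fun p => ?_
  simp only [Module.End.mul_apply, creation_apply, map_sub, Derivation.leibniz, smul_eq_mul,
    pderiv_pderiv_comm i j, MvPolynomial.pderiv_X, Pi.single_apply]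
  by_cases h : i = j
  · subst h; ring
  · simp only [h, Ne.symm h, if_false]
    ring

/-- The Hermite polynomial `H_α = h_α / f_∞`. -/
def hermitePoly {d : ℕ} (α : Fin d → ℕ) : MvPolynomial (Fin d) ℝ :=
  ((List.finRange d).map fun i => creation i ^ α i).prod 1

theorem iterate_partialDeriv_mul_gaussian {d : ℕ} (i : Fin d) (n : ℕ) (c : ℝ)
    (p : MvPolynomial (Fin d) ℝ) :
    (partialDeriv i)^[n] (fun x => MvPolynomial.eval x.ofLp (c • p) * gaussian d x) = fun x =>
      MvPolynomial.eval x.ofLp ((c * (-1) ^ n) • (creation i ^ n) p) * gaussian d x := by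
  induction n with
  | zero => simp
  | succ n ih =>
    rw [Function.iterate_succ_apply', ih, partialDeriv_mul_gaussian]
    funext x
    congr 2
    rw [pow_succ' (creation i), Module.End.mul_apply, creation_apply]
    simp only [Derivation.map_smul, mul_smul_comm, pow_succ]
    module

theorem hermiteFun_eq {d : ℕ} (α : Fin d → ℕ) :
    hermiteFun α = fun x => MvPolynomial.eval x.ofLp (hermitePoly α) * gaussian d x := by
  have key : ∀ l : List (Fin d), l.foldr (fun i v => (partialDeriv i)^[α i] v) (gaussian d)
      = fun x => MvPolynomial.eval x.ofLp (((-1 : ℝ) ^ (l.map α).sum) •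
        (l.map fun i => creation i ^ α i).prod 1) * gaussian d x := by
    intro l
    induction l with
    | nil => simp
    | cons i l ih =>
      rw [List.foldr_cons, ih, iterate_partialDeriv_mul_gaussian]
      simp only [List.map_cons, List.sum_cons, List.prod_cons, Module.End.mul_apply]
      rw [pow_add, mul_comm]
  funext x
  unfold hermiteFun multiDeriv hermitePoly
  have hs : ((List.finRange d).map α).sum = order α := by
    rw [order, ← List.ofFn_eq_map, List.sum_ofFn]
  simp only [key, hs, MvPolynomial.smul_eval]
  rw [← mul_assoc, ← mul_assoc, ← mul_pow]
  simp

theorem hermitePoly_zero {d : ℕ} : hermitePoly (0 : Fin d → ℕ) = 1 := by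
  have : ((List.finRange d).map fun i => creation i ^ (0 : Fin d → ℕ) i).prod = 1 := by simp
  rw [hermitePoly, this, Module.End.one_apply]

theorem hermitePoly_add_single {d : ℕ} (α : Fin d → ℕ) (j : Fin d) :
    hermitePoly (α + Pi.single j 1) = creation j (hermitePoly α) := by
  have key : ∀ l : List (Fin d), l.Nodup →
      (l.map fun i => creation i ^ (α + Pi.single j 1 : Fin d → ℕ) i).prod
        = (if j ∈ l then creation j else 1) * (l.map fun i => creation i ^ α i).prod := by
    intro l hl
    induction l with
    | nil => simp
    | cons i l ih =>
      rw [List.nodup_cons] at hl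
      simp only [List.map_cons, List.prod_cons, ih hl.2]
      by_cases h : j = i
      · subst h
        simp [hl.1, pow_succ', mul_assoc]
      · simp only [Pi.add_apply, Pi.single_apply, Ne.symm h, if_false, add_zero, List.mem_cons, h,
          false_or]
        rw [← mul_assoc, ← mul_assoc]
        congr 1
        split_ifs
        · exact ((commute_creation i j).pow_left _).eq
        · simp
  rw [hermitePoly, key _ (List.nodup_finRange d)]
  simp [hermitePoly]

theorem single_one_le {d : ℕ} {α : Fin d → ℕ} {j : Fin d} (h : α j ≠ 0) :
    Pi.single j 1 ≤ α := by
  intro k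
  by_cases hk : k = j
  · subst hk
    simpa using Nat.one_le_iff_ne_zero.2 h
  · simp [hk]

@[elab_as_elim]
theorem multiIndex_induction {d : ℕ} {P : (Fin d → ℕ) → Prop} (zero : P 0)
    (add : ∀ α j, P α → P (α + Pi.single j 1)) (α : Fin d → ℕ) : P α := by
  induction h : order α generalizing α with
  | zero =>
    have : α = 0 := by
      funext i
      simpa using (Finset.sum_eq_zero_iff.1 h) i (Finset.mem_univ i)
    exact this ▸ zero
  | succ n ih =>
    obtain ⟨j, hj⟩ : ∃ j, α j ≠ 0 := by
      by_contra! h'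
      simp [order, h'] at h
    have e : α = (α - Pi.single j 1) + Pi.single j 1 :=
      (tsub_add_cancel_of_le (single_one_le hj)).symm
    rw [e]
    refine add _ _ (ih _ ?_)
    rw [e] at h
    simp only [order, Pi.add_apply, Finset.sum_add_distrib, Finset.sum_pi_single',
      Finset.mem_univ, if_true] at h ⊢
    omega

theorem order_add_single {d : ℕ} (α : Fin d → ℕ) (j : Fin d) :
    order (α + Pi.single j 1) = order α + 1 := by
  simp [order, Finset.sum_add_distrib]

theorem multiFactorial_add_single {d : ℕ} (α : Fin d → ℕ) (j : Fin d) :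
    multiFactorial (α + Pi.single j 1) = (α j + 1) * multiFactorial α := by
  unfold multiFactorial
  rw [← Finset.mul_prod_erase _ _ (Finset.mem_univ j),
    ← Finset.mul_prod_erase _ (fun i => (α i).factorial) (Finset.mem_univ j), ← mul_assoc]
  congr 1
  · simp [Nat.factorial_succ]
  · refine Finset.prod_congr rfl fun i hi => ?_
    simp [Finset.ne_of_mem_erase hi]

theorem multiFactorial_pos {d : ℕ} (α : Fin d → ℕ) : 0 < multiFactorial α :=
  Finset.prod_pos fun _ _ => Nat.factorial_pos _

/-- `∂ᵢ H_α = αᵢ H_{α - eᵢ}`. The truncated subtraction is harmless: the coefficient vanishes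
where it is in force. -/
theorem pderiv_hermitePoly {d : ℕ} (i : Fin d) (α : Fin d → ℕ) :
    MvPolynomial.pderiv i (hermitePoly α) = (α i : ℝ) • hermitePoly (α - Pi.single i 1) := by
  induction α using multiIndex_induction with
  | zero => simp [hermitePoly_zero]
  | add α j ih =>
    rw [hermitePoly_add_single, pderiv_creation, ih, map_smul, ← hermitePoly_add_single]
    by_cases h : i = j
    · subst h
      rcases Nat.eq_zero_or_pos (α i) with h0 | h0
      · simp [h0, add_tsub_cancel_right]
      · rw [add_tsub_cancel_right, tsub_add_cancel_of_le (single_one_le h0.ne')]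
        simp only [if_true, Pi.add_apply, Pi.single_eq_same, Nat.cast_add, Nat.cast_one]
        module
    · simp only [h, if_false, add_zero, Pi.add_apply, Pi.single_apply]
      congr 2
      funext k
      simp only [Pi.add_apply, Pi.sub_apply, Pi.single_apply]
      by_cases hk : k = i
      · subst hk; simp [h]
      · simp [hk]

/-- The Hermite polynomials span all polynomials. -/
theorem span_hermitePoly (d : ℕ) :
    Submodule.span ℝ (range (hermitePoly (d := d))) = ⊤ := by
  rw [eq_top_iff]
  rintro p -
  induction p using MvPolynomial.induction_on with
  | C a =>
    have : (MvPolynomial.C a : MvPolynomial (Fin d) ℝ) = a • hermitePoly 0 := by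
      rw [hermitePoly_zero, MvPolynomial.smul_eq_C_mul, mul_one]
    rw [this]
    exact Submodule.smul_mem _ _ (Submodule.subset_span ⟨0, rfl⟩)
  | add p q hp hq => exact Submodule.add_mem _ hp hq
  | mul_X p j hp =>
    induction hp using Submodule.span_induction with
    | mem x hx =>
      obtain ⟨α, rfl⟩ := hx
      have : hermitePoly α * MvPolynomial.X j
          = hermitePoly (α + Pi.single j 1) + (α j : ℝ) • hermitePoly (α - Pi.single j 1) := by
        rw [hermitePoly_add_single, creation_apply, pderiv_hermitePoly]
        ring
      rw [this]
      exact Submodule.add_mem _ (Submodule.subset_span ⟨_, rfl⟩)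
        (Submodule.smul_mem _ _ (Submodule.subset_span ⟨_, rfl⟩))
    | zero => simp
    | add x y _ _ hx hy => rw [add_mul]; exact Submodule.add_mem _ hx hy
    | smul a x _ hx => rw [smul_mul_assoc]; exact Submodule.smul_mem _ _ hx

/-! ### Gaussian integrals of polynomials -/

theorem integral_gaussian (d : ℕ) : ∫ x, gaussian d x = 1 := by
  unfold gaussian
  have h := GaussianFourier.integral_rexp_neg_mul_sq_norm (V := Space d) (b := 1 / 2)
    (by norm_num)
  have e : ∀ x : Space d, Real.exp (-‖x‖ ^ 2 / 2) = Real.exp (-(1 / 2) * ‖x‖ ^ 2) := fun x => by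
    congr 1; ring
  simp only [e]
  rw [integral_const_mul, h, finrank_euclideanSpace_fin,
    show Real.pi / (1 / 2) = 2 * Real.pi by ring]
  exact inv_mul_cancel₀ (by positivity)

theorem differentiable_eval {d : ℕ} (p : MvPolynomial (Fin d) ℝ) :
    Differentiable ℝ fun x : Space d => MvPolynomial.eval x.ofLp p := fun x =>
  let ⟨_, hA, _⟩ := hasFDerivAt_eval p x
  hA.differentiableAt

theorem differentiable_gaussian (d : ℕ) : Differentiable ℝ (gaussian d) := fun x =>
  (hasFDerivAt_gaussian d x).differentiableAt

theorem partialDeriv_eval {d : ℕ} (p : MvPolynomial (Fin d) ℝ) (i : Fin d) :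
    partialDeriv i (fun x => MvPolynomial.eval x.ofLp p)
      = fun x => MvPolynomial.eval x.ofLp (MvPolynomial.pderiv i p) := by
  funext x
  obtain ⟨A, hA, hA'⟩ := hasFDerivAt_eval p x
  rw [partialDeriv, hA.fderiv, hA']

theorem integral_creation_mul_gaussian {d : ℕ} (i : Fin d) (p : MvPolynomial (Fin d) ℝ) :
    ∫ x : Space d, MvPolynomial.eval x.ofLp (creation i p) * gaussian d x = 0 := by
  have h := integral_mul_fderiv_eq_neg_fderiv_mul_of_integrable (𝕜 := ℝ) (μ := volume)
    (f := fun _ : Space d => (1 : ℝ))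
    (g := fun x : Space d => MvPolynomial.eval x.ofLp p * gaussian d x)
    (v := EuclideanSpace.single i 1) (by simp) ?_ (by simpa using integrable_eval_mul_gaussian p)
    (fun _ _ => by fun_prop)
    (fun x _ => ((differentiable_eval p x).mul (differentiable_gaussian d x)))
  · have e := partialDeriv_mul_gaussian p i
    unfold partialDeriv at e
    simp only [one_mul, fderiv_fun_const, Pi.zero_apply, zero_mul, integral_zero, neg_zero,
      zero_apply] at h
    rw [e] at h
    rw [← neg_eq_zero, ← integral_neg]
    refine Eq.trans (integral_congr_ae (Eventually.of_forall fun x => ?_)) h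
    simp only [creation_apply, map_sub]
    ring
  · have e := partialDeriv_mul_gaussian p i
    unfold partialDeriv at e
    simp only [one_mul, e]
    exact integrable_eval_mul_gaussian _

/-- The creation operator is the adjoint of the partial derivative for the Gaussian measure. -/
theorem integral_creation_mul {d : ℕ} (i : Fin d) (p q : MvPolynomial (Fin d) ℝ) :
    ∫ x : Space d, MvPolynomial.eval x.ofLp (creation i p * q) * gaussian d x
      = ∫ x : Space d, MvPolynomial.eval x.ofLp (p * MvPolynomial.pderiv i q) * gaussian d x := by
  have h := integral_creation_mul_gaussian i (p * q)
  have e : creation i (p * q) = creation i p * q - p * MvPolynomial.pderiv i q := by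
    simp only [creation_apply, Derivation.leibniz, smul_eq_mul]
    ring
  simp only [e, map_sub, sub_mul] at h
  rw [integral_sub (integrable_eval_mul_gaussian _) (integrable_eval_mul_gaussian _),
    sub_eq_zero] at h
  exact h

/-- The Hermite polynomials are orthogonal for the Gaussian measure. -/
theorem integral_hermitePoly_mul {d : ℕ} (α β : Fin d → ℕ) :
    ∫ x : Space d, MvPolynomial.eval x.ofLp (hermitePoly α * hermitePoly β) * gaussian d x
      = if α = β then (multiFactorial α : ℝ) else 0 := by
  induction α using multiIndex_induction generalizing β with
  | zero =>
    induction β using multiIndex_induction with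
    | zero => simp [hermitePoly_zero, integral_gaussian, multiFactorial]
    | add β j _ =>
      have hne : (0 : Fin d → ℕ) ≠ β + Pi.single j 1 := fun h => by
        have := congrFun h j
        simp at this
      rw [hermitePoly_add_single, mul_comm, integral_creation_mul, hermitePoly_zero, if_neg hne]
      simp
  | add α j ih =>
    rw [hermitePoly_add_single, integral_creation_mul, pderiv_hermitePoly]
    simp only [mul_smul_comm, MvPolynomial.smul_eval, mul_assoc]
    rw [integral_const_mul, ih]
    rcases Nat.eq_zero_or_pos (β j) with h0 | h0
    · have hne : α + Pi.single j 1 ≠ β := fun h => by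
        rw [← h] at h0
        simp at h0
      simp [h0, hne]
    · have hle := single_one_le h0.ne'
      have hiff : α = β - Pi.single j 1 ↔ α + Pi.single j 1 = β :=
        ⟨fun h => by rw [h, tsub_add_cancel_of_le hle],
          fun h => by rw [← h, add_tsub_cancel_right]⟩
      by_cases h : α + Pi.single j 1 = β
      · rw [if_pos (hiff.2 h), if_pos h, multiFactorial_add_single, ← h]
        simp
      · rw [if_neg (fun h' => h (hiff.1 h')), if_neg h, mul_zero]

/-! ### The pairing of `L²(f_∞⁻¹)` with functions of polynomial growth -/

theorem measurable_ofReal_inv_gaussian (d : ℕ) :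
    Measurable fun x => ENNReal.ofReal (gaussian d x)⁻¹ :=
  (continuous_gaussian d).measurable.inv.ennreal_ofReal

theorem integral_invGaussianMeasure {d : ℕ} (g : Space d → ℝ) :
    ∫ x, g x ∂invGaussianMeasure d = ∫ x, (gaussian d x)⁻¹ * g x := by
  unfold invGaussianMeasure
  rw [integral_withDensity_eq_integral_toReal_smul
    (measurable_ofReal_inv_gaussian d) (Eventually.of_forall fun _ => by simp)]
  refine integral_congr_ae (Eventually.of_forall fun x => ?_)
  simp only [smul_eq_mul]
  rw [ENNReal.toReal_ofReal (inv_nonneg.2 (gaussian_pos d x).le)]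

theorem integrable_invGaussianMeasure {d : ℕ} {g : Space d → ℝ} :
    Integrable g (invGaussianMeasure d) ↔ Integrable fun x => (gaussian d x)⁻¹ * g x := by
  unfold invGaussianMeasure
  rw [integrable_withDensity_iff_integrable_smul'
    (measurable_ofReal_inv_gaussian d) (Eventually.of_forall fun _ => by simp)]
  refine integrable_congr (Eventually.of_forall fun x => ?_)
  simp only [smul_eq_mul]
  rw [ENNReal.toReal_ofReal (inv_nonneg.2 (gaussian_pos d x).le)]

theorem ae_invGaussianMeasure {d : ℕ} : ae (invGaussianMeasure d) = ae volume := by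
  refine le_antisymm (withDensity_absolutelyContinuous _ _).ae_le
    (withDensity_absolutelyContinuous'
      (measurable_ofReal_inv_gaussian d).aemeasurable
      (Eventually.of_forall fun x => ?_)).ae_le
  simpa using gaussian_pos d x

theorem memLp_mul_gaussian {d : ℕ} {ψ : Space d → ℝ} (hψ : AEStronglyMeasurable ψ volume)
    (h : Integrable fun x => ψ x ^ 2 * gaussian d x) :
    MemLp (fun x => ψ x * gaussian d x) 2 (invGaussianMeasure d) := by
  have hm : AEStronglyMeasurable (fun x => ψ x * gaussian d x) (invGaussianMeasure d) :=
    (hψ.mul (continuous_gaussian d).aestronglyMeasurable).mono_ac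
      (withDensity_absolutelyContinuous _ _)
  rw [memLp_two_iff_integrable_sq hm, integrable_invGaussianMeasure]
  refine h.congr (Eventually.of_forall fun x => ?_)
  have := gaussian_pos d x
  field_simp

theorem memLp_mul_gaussian_of_le {d : ℕ} {ψ : Space d → ℝ} (hψ : AEStronglyMeasurable ψ volume)
    (P : MvPolynomial (Fin d) ℝ) (h : ∀ x, |ψ x| ≤ MvPolynomial.eval x.ofLp P) :
    MemLp (fun x => ψ x * gaussian d x) 2 (invGaussianMeasure d) := by
  refine memLp_mul_gaussian hψ ((integrable_eval_mul_gaussian (P ^ 2)).mono'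
    ((hψ.pow 2).mul (continuous_gaussian d).aestronglyMeasurable)
    (Eventually.of_forall fun x => ?_))
  have h0 := gaussian_pos d x
  rw [norm_mul, Real.norm_of_nonneg h0.le, norm_pow, Real.norm_eq_abs, map_pow]
  gcongr
  exact h x

theorem abs_eval_le_eval {d : ℕ} (p : MvPolynomial (Fin d) ℝ) (x : Space d) :
    |MvPolynomial.eval x.ofLp p| ≤ MvPolynomial.eval x.ofLp (1 + p ^ 2) := by
  simp only [map_add, map_one, map_pow]
  rw [abs_le]
  constructor <;> nlinarith [sq_nonneg (MvPolynomial.eval x.ofLp p - 1),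
    sq_nonneg (MvPolynomial.eval x.ofLp p + 1)]

theorem memLp_eval_mul_gaussian {d : ℕ} (p : MvPolynomial (Fin d) ℝ) :
    MemLp (fun x : Space d => MvPolynomial.eval x.ofLp p * gaussian d x) 2
      (invGaussianMeasure d) :=
  memLp_mul_gaussian_of_le (continuous_eval p).aestronglyMeasurable (1 + p ^ 2)
    (abs_eval_le_eval p)

theorem inner_toLp_mul_gaussian {d : ℕ} (u : WeightedL2 d) {ψ : Space d → ℝ}
    (h : MemLp (fun x => ψ x * gaussian d x) 2 (invGaussianMeasure d)) :
    inner ℝ u (h.toLp _) = ∫ x, u x * ψ x := by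
  rw [L2.inner_def, integral_invGaussianMeasure]
  have := h.coeFn_toLp
  rw [EventuallyEq, ae_invGaussianMeasure] at this
  refine integral_congr_ae (this.mono fun x hx => ?_)
  have := gaussian_pos d x
  simp only [hx, RCLike.inner_apply, conj_trivial]
  field_simp

theorem integrable_mul_of_memLp {d : ℕ} (u : WeightedL2 d) {ψ : Space d → ℝ}
    (h : MemLp (fun x => ψ x * gaussian d x) 2 (invGaussianMeasure d)) :
    Integrable fun x => u x * ψ x := by
  have h1 := integrable_invGaussianMeasure.1 (L2.integrable_inner (𝕜 := ℝ) u (h.toLp _))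
  have := h.coeFn_toLp
  rw [EventuallyEq, ae_invGaussianMeasure] at this
  refine h1.congr (this.mono fun x hx => ?_)
  have := gaussian_pos d x
  simp only [hx, RCLike.inner_apply, conj_trivial]
  field_simp

theorem norm_sq_toLp_mul_gaussian {d : ℕ} {ψ : Space d → ℝ}
    (h : MemLp (fun x => ψ x * gaussian d x) 2 (invGaussianMeasure d)) :
    ‖h.toLp _‖ ^ 2 = ∫ x, ψ x ^ 2 * gaussian d x := by
  rw [← real_inner_self_eq_norm_sq, inner_toLp_mul_gaussian]
  have := h.coeFn_toLp
  rw [EventuallyEq, ae_invGaussianMeasure] at this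
  refine integral_congr_ae (this.mono fun x hx => ?_)
  simp only [hx]
  ring

theorem integrable_mul_eval {d : ℕ} (u : WeightedL2 d) (p : MvPolynomial (Fin d) ℝ) :
    Integrable fun x => u x * MvPolynomial.eval x.ofLp p :=
  integrable_mul_of_memLp u (memLp_eval_mul_gaussian p)

theorem integrable_coe {d : ℕ} (u : WeightedL2 d) : Integrable (u : Space d → ℝ) := by
  simpa using integrable_mul_eval u 1

theorem hermite_eq {d : ℕ} (α : Fin d → ℕ) :
    hermite α = (memLp_eval_mul_gaussian (hermitePoly α)).toLp _ :=
  MemLp.toLp_congr _ _ (by rw [hermiteFun_eq])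

theorem inner_hermite {d : ℕ} (u : WeightedL2 d) (α : Fin d → ℕ) :
    inner ℝ u (hermite α) = ∫ x, u x * MvPolynomial.eval x.ofLp (hermitePoly α) := by
  rw [hermite_eq, inner_toLp_mul_gaussian]

theorem inner_hermite_hermite {d : ℕ} (α β : Fin d → ℕ) :
    inner ℝ (hermite α) (hermite β) = if α = β then (multiFactorial α : ℝ) else 0 := by
  rw [inner_hermite, ← integral_hermitePoly_mul, hermite_eq]
  have := (memLp_eval_mul_gaussian (hermitePoly α)).coeFn_toLp
  rw [EventuallyEq, ae_invGaussianMeasure] at this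
  refine integral_congr_ae (this.mono fun x hx => ?_)
  simp only [hx, map_mul]
  ring

/-! ### Completeness of the Hermite functions -/

theorem memLp_exp_inner_mul_gaussian {d : ℕ} (ξ : Space d) :
    MemLp (fun x => Real.exp (inner ℝ x ξ) * gaussian d x) 2 (invGaussianMeasure d) := by
  refine memLp_mul_gaussian (by fun_prop) ?_
  have h0 := (GaussianFourier.integrable_cexp_neg_mul_sq_norm_add (V := Space d)
      (b := (1 / 2 : ℂ)) (by norm_num) 2 ξ).norm.const_mul ((2 * Real.pi) ^ ((d : ℝ) / 2))⁻¹
  refine h0.congr (Eventually.of_forall fun x => ?_)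
  simp only [Complex.norm_exp, gaussian]
  rw [← Real.exp_nat_mul, mul_left_comm, ← Real.exp_add]
  congr 2
  have : (-(1 / 2 : ℂ) * (‖x‖ : ℂ) ^ 2 + 2 * ((inner ℝ ξ x : ℝ) : ℂ))
      = ((-(1 / 2) * ‖x‖ ^ 2 + 2 * inner ℝ ξ x : ℝ) : ℂ) := by push_cast; ring
  rw [this, Complex.ofReal_re, real_inner_comm]
  push_cast
  ring

theorem integrable_mul_exp_abs {d : ℕ} (u : WeightedL2 d) (ξ : Space d) :
    Integrable fun x => |u x| * Real.exp |inner ℝ x ξ| := by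
  have h1 := (integrable_mul_of_memLp u (memLp_exp_inner_mul_gaussian ξ)).norm
  have h2 := (integrable_mul_of_memLp u (memLp_exp_inner_mul_gaussian (-ξ))).norm
  refine (h1.add h2).mono' ?_ (Eventually.of_forall fun x => ?_)
  · have hu := (Lp.stronglyMeasurable u).aestronglyMeasurable (μ := volume)
    have : Continuous fun x : Space d => Real.exp |inner ℝ x ξ| := by fun_prop
    exact hu.norm.mul this.aestronglyMeasurable
  · simp only [norm_mul, Real.norm_eq_abs, abs_abs, Real.abs_exp, Pi.add_apply, inner_neg_right]
    rw [← mul_add]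
    gcongr
    rcases abs_choice (inner ℝ x ξ) with h | h <;> rw [h]
    · linarith [Real.exp_pos (-inner ℝ x ξ)]
    · linarith [Real.exp_pos (inner ℝ x ξ)]

/-- The Fourier transform of a function that is orthogonal to all polynomials vanishes: expand the
character into its power series. -/
theorem integral_mul_cexp_eq_zero {d : ℕ} (u : WeightedL2 d)
    (h : ∀ p : MvPolynomial (Fin d) ℝ, ∫ x, u x * MvPolynomial.eval x.ofLp p = 0)
    (ξ : Space d) : ∫ x, (u x : ℂ) * Complex.exp (inner ℝ x ξ * Complex.I) = 0 := by
  have hu := (Lp.stronglyMeasurable u).aestronglyMeasurable (μ := volume)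
  have hs := hasSum_integral_of_dominated_convergence (μ := volume)
    (F := fun (n : ℕ) (x : Space d) => (u x : ℂ) * ((n.factorial : ℂ)⁻¹ *
      (inner ℝ x ξ * Complex.I) ^ n))
    (f := fun x => (u x : ℂ) * Complex.exp (inner ℝ x ξ * Complex.I))
    (bound := fun n x => |u x| * (|inner ℝ x ξ| ^ n / n.factorial)) ?_ ?_ ?_ ?_ ?_
  · refine hs.unique ?_
    convert hasSum_zero using 1
    funext n
    have e : ∀ x : Space d, inner ℝ x ξ
        = MvPolynomial.eval x.ofLp (∑ i, MvPolynomial.C (ξ i) * MvPolynomial.X i) := fun x => by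
      simp [PiLp.inner_apply]
    have h1 := h ((∑ i, MvPolynomial.C (ξ i) * MvPolynomial.X i) ^ n)
    simp only [map_pow, ← e] at h1
    have h2 : ∀ x : Space d, (u x : ℂ) * ((n.factorial : ℂ)⁻¹ * (inner ℝ x ξ * Complex.I) ^ n)
        = ((n.factorial : ℂ)⁻¹ * Complex.I ^ n) * ((u x * inner ℝ x ξ ^ n : ℝ) : ℂ) := fun x => by
      push_cast
      ring
    simp only [h2]
    rw [integral_const_mul, integral_complex_ofReal, h1]
    simp
  · intro n
    have : Continuous fun x : Space d => (n.factorial : ℂ)⁻¹ *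
      ((inner ℝ x ξ : ℝ) * Complex.I) ^ n := by fun_prop
    exact (Complex.continuous_ofReal.comp_aestronglyMeasurable hu).mul this.aestronglyMeasurable
  · refine fun n => Eventually.of_forall fun x => le_of_eq ?_
    simp [div_eq_inv_mul]
  · exact Eventually.of_forall fun x => (Real.summable_pow_div_factorial _).mul_left _
  · refine (integrable_mul_exp_abs u ξ).congr (Eventually.of_forall fun x => ?_)
    simp only
    rw [tsum_mul_left, Real.exp_eq_exp_ℝ, NormedSpace.exp_eq_tsum_div]
  · refine Eventually.of_forall fun x => HasSum.mul_left _ ?_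
    have := NormedSpace.exp_series_hasSum_exp' (𝕂 := ℂ) ((inner ℝ x ξ : ℝ) * Complex.I)
    rw [← Complex.exp_eq_exp_ℂ] at this
    simpa using this

theorem eq_zero_of_integral_mul_eval_eq_zero {d : ℕ} (u : WeightedL2 d)
    (h : ∀ p : MvPolynomial (Fin d) ℝ, ∫ x, u x * MvPolynomial.eval x.ofLp p = 0) : u = 0 := by
  have hi := integrable_coe u
  have hm : Measurable (u : Space d → ℝ) := (Lp.stronglyMeasurable u).measurable
  -- The positive and the negative part of `u` are densities of finite measures with the same
  -- characteristic function.
  let μ (v : Space d → ℝ) : Measure (Space d) := volume.withDensity fun x => ENNReal.ofReal (v x)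
  have hfin : ∀ v : Space d → ℝ, Integrable v → IsFiniteMeasure (μ v) := fun v hv =>
    isFiniteMeasure_withDensity_ofReal hv.2
  have hp := hfin _ hi
  have hn := hfin _ hi.neg
  have hchar : ∀ v : Space d → ℝ, Measurable v → ∀ ξ, charFun (μ v) ξ
      = ∫ x, ((max (v x) 0 : ℝ) : ℂ) * Complex.exp (inner ℝ x ξ * Complex.I) := fun v hv ξ => by
    rw [charFun_apply, integral_withDensity_eq_integral_toReal_smul hv.ennreal_ofReal
      (Eventually.of_forall fun _ => by simp)]
    simp only [ENNReal.toReal_ofReal', Complex.real_smul]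
  have hint : ∀ v : Space d → ℝ, Integrable v → ∀ ξ : Space d, Integrable fun x =>
      ((max (v x) 0 : ℝ) : ℂ) * Complex.exp (inner ℝ x ξ * Complex.I) := fun v hv ξ => by
    have hc : Continuous fun x : Space d => Complex.exp ((inner ℝ x ξ : ℝ) * Complex.I) := by
      fun_prop
    refine (hv.pos_part.ofReal (𝕜 := ℂ)).mul_bdd (c := 1) hc.aestronglyMeasurable
      (Eventually.of_forall fun x => ?_)
    rw [Complex.norm_exp_ofReal_mul_I]
  have heq : μ u = μ (-u) := by
    refine Measure.ext_of_charFun (funext fun ξ => ?_)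
    rw [hchar _ hm, hchar _ hm.neg, ← sub_eq_zero, ← integral_sub (hint _ hi ξ) (hint _ hi.neg ξ),
      ← integral_mul_cexp_eq_zero u h ξ]
    refine integral_congr_ae (Eventually.of_forall fun x => ?_)
    simp only [Pi.neg_apply]
    rw [← sub_mul, ← Complex.ofReal_sub]
    congr 2
    rcases le_total 0 (u x) with h0 | h0
    · rw [max_eq_left h0, max_eq_right (by linarith), sub_zero]
    · rw [max_eq_right h0, max_eq_left (by linarith)]; ring
  have hae : (fun x => ENNReal.ofReal (u x)) =ᵐ[volume]
      fun x => ENNReal.ofReal ((-(u : Space d → ℝ)) x) := by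
    refine (withDensity_eq_iff hm.ennreal_ofReal.aemeasurable
      hm.neg.ennreal_ofReal.aemeasurable ?_).1 heq
    exact hi.lintegral_lt_top.ne
  rw [Lp.eq_zero_iff_ae_eq_zero, EventuallyEq, ae_invGaussianMeasure]
  refine hae.mono fun x hx => ?_
  simp only [Pi.neg_apply] at hx
  rcases lt_trichotomy (u x) 0 with h0 | h0 | h0
  · rw [ENNReal.ofReal_of_nonpos h0.le, eq_comm, ENNReal.ofReal_eq_zero] at hx
    linarith
  · exact h0
  · rw [ENNReal.ofReal_of_nonpos (p := -u x) (by linarith), ENNReal.ofReal_eq_zero] at hx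
    linarith

theorem eq_zero_of_inner_hermite_eq_zero {d : ℕ} (u : WeightedL2 d)
    (h : ∀ α : Fin d → ℕ, inner ℝ u (hermite α) = 0) : u = 0 := by
  refine eq_zero_of_integral_mul_eval_eq_zero u fun p => ?_
  have hp : p ∈ Submodule.span ℝ (range (hermitePoly (d := d))) := by
    rw [span_hermitePoly]; trivial
  induction hp using Submodule.span_induction with
  | mem p hp =>
    obtain ⟨α, rfl⟩ := hp
    rw [← inner_hermite, h]
  | zero => simp
  | add p q _ _ hp hq =>
    simp only [map_add, mul_add]
    rw [integral_add (integrable_mul_eval u p) (integrable_mul_eval u q), hp, hq, add_zero]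
  | smul a p _ hp =>
    simp only [MvPolynomial.smul_eval, mul_left_comm _ a]
    rw [integral_const_mul, hp, mul_zero]

theorem orthonormal_hermite (d : ℕ) :
    Orthonormal ℝ fun α : Fin d → ℕ => (√(multiFactorial α))⁻¹ • hermite α := by
  rw [orthonormal_iff_ite]
  intro α β
  rw [real_inner_smul_left, real_inner_smul_right, inner_hermite_hermite]
  split_ifs with h
  · subst h
    have : (0 : ℝ) < multiFactorial α := by exact_mod_cast multiFactorial_pos α
    rw [← mul_assoc, ← mul_inv, Real.mul_self_sqrt this.le, inv_mul_cancel₀ this.ne']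
  · simp

/-- The Hilbert basis of `L²(f_∞⁻¹)` given by the normalised Hermite functions. -/
def hermiteBasis (d : ℕ) : HilbertBasis (Fin d → ℕ) ℝ (WeightedL2 d) :=
  HilbertBasis.mkOfOrthogonalEqBot (orthonormal_hermite d) <| by
    rw [Submodule.eq_bot_iff]
    intro u hu
    refine eq_zero_of_inner_hermite_eq_zero u fun α => ?_
    have h := Submodule.mem_orthogonal' _ u |>.1 hu _ (Submodule.subset_span ⟨α, rfl⟩)
    have : (0 : ℝ) < multiFactorial α := by exact_mod_cast multiFactorial_pos α
    rw [real_inner_smul_right] at h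
    exact (mul_eq_zero.1 h).resolve_left (by positivity)

theorem hermiteBasis_apply {d : ℕ} (α : Fin d → ℕ) :
    hermiteBasis d α = (√(multiFactorial α))⁻¹ • hermite α := by
  simp [hermiteBasis]

theorem inner_hermite_eq_hermiteCoeff {d : ℕ} (u : WeightedL2 d) (α : Fin d → ℕ) :
    inner ℝ u (hermite α) = multiFactorial α * hermiteCoeff u α := by
  have : (0 : ℝ) < multiFactorial α := by exact_mod_cast multiFactorial_pos α
  rw [hermiteCoeff, mul_div_cancel₀ _ this.ne']

theorem hasSum_hermiteCoeff {d : ℕ} (u : WeightedL2 d) :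
    HasSum (fun α => hermiteCoeff u α • hermite α) u := by
  convert (hermiteBasis d).hasSum_repr u using 2 with α
  have : (0 : ℝ) < multiFactorial α := by exact_mod_cast multiFactorial_pos α
  rw [HilbertBasis.repr_apply_apply, hermiteBasis_apply, real_inner_smul_left, real_inner_comm,
    inner_hermite_eq_hermiteCoeff, smul_smul]
  congr 1
  nth_rewrite 2 [← Real.mul_self_sqrt this.le]
  field_simp

theorem hasSum_hermiteCoeff_sq {d : ℕ} (u : WeightedL2 d) :
    HasSum (fun α => (multiFactorial α : ℝ) * hermiteCoeff u α ^ 2) (‖u‖ ^ 2) := by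
  rw [← real_inner_self_eq_norm_sq]
  refine ((hermiteBasis d).hasSum_inner_mul_inner u u).congr_fun fun α => ?_
  have : (0 : ℝ) < multiFactorial α := by exact_mod_cast multiFactorial_pos α
  rw [real_inner_comm u, hermiteBasis_apply, real_inner_smul_right,
    inner_hermite_eq_hermiteCoeff]
  have h3 : √(multiFactorial α : ℝ) ≠ 0 := by positivity
  field_simp
  rw [Real.sq_sqrt this.le, mul_comm]

theorem exists_hermiteCoeff_eq {d : ℕ} (c : (Fin d → ℕ) → ℝ)
    (hc : Summable fun α => (multiFactorial α : ℝ) * c α ^ 2) :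
    ∃ u : WeightedL2 d, ∀ α, hermiteCoeff u α = c α := by
  have hmem : Memℓp (fun α => √(multiFactorial α) * c α) 2 := by
    refine memℓp_gen ?_
    refine hc.congr fun α => ?_
    simp [mul_pow]
  refine ⟨(hermiteBasis d).repr.symm ⟨_, hmem⟩, fun α => ?_⟩
  have : (0 : ℝ) < multiFactorial α := by exact_mod_cast multiFactorial_pos α
  have h3 : √(multiFactorial α : ℝ) ≠ 0 := by positivity
  have h := HilbertBasis.repr_apply_apply (hermiteBasis d)
    ((hermiteBasis d).repr.symm ⟨_, hmem⟩) α
  rw [LinearIsometryEquiv.apply_symm_apply, hermiteBasis_apply, real_inner_smul_left,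
    real_inner_comm, inner_hermite_eq_hermiteCoeff] at h
  change √(multiFactorial α : ℝ) * c α = _ at h
  field_simp at h
  rw [Real.sq_sqrt this.le] at h
  exact (mul_left_cancel₀ this.ne' h).symm

/-! ### The Fisher information in terms of the Hermite coefficients -/

theorem contDiff_partialDeriv {d : ℕ} {φ : Space d → ℝ} (h : ContDiff ℝ ∞ φ) (i : Fin d) :
    ContDiff ℝ ∞ (partialDeriv i φ) :=
  (h.fderiv_right (m := ∞) (by simp)).clm_apply contDiff_const

theorem IsTestFunction.partialDeriv {d : ℕ} {φ : Space d → ℝ} (h : IsTestFunction φ)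
    (i : Fin d) : IsTestFunction (partialDeriv i φ) :=
  ⟨contDiff_partialDeriv h.1 i, h.2.fderiv_apply (𝕜 := ℝ) _⟩

theorem IsTestFunction.continuous {d : ℕ} {φ : Space d → ℝ} (h : IsTestFunction φ) :
    Continuous φ := h.1.continuous

theorem IsTestFunction.memLp {d : ℕ} {φ : Space d → ℝ} (h : IsTestFunction φ) :
    MemLp (fun x => φ x / gaussian d x * gaussian d x) 2 (invGaussianMeasure d) := by
  have hc : Continuous fun x => φ x / gaussian d x :=
    h.continuous.div (continuous_gaussian d) fun x => (gaussian_pos d x).ne'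
  refine memLp_mul_gaussian hc.aestronglyMeasurable ?_
  refine ((hc.pow 2).mul (continuous_gaussian d)).integrable_of_hasCompactSupport
    (h.2.mono fun x hx => ?_)
  rw [Function.mem_support] at hx ⊢
  intro h0
  simp [h0] at hx

theorem integral_eval_mul_partialDeriv {d : ℕ} (p : MvPolynomial (Fin d) ℝ) {φ : Space d → ℝ}
    (h : IsTestFunction φ) (i : Fin d) :
    ∫ x, MvPolynomial.eval x.ofLp p * partialDeriv i φ x
      = -∫ x, MvPolynomial.eval x.ofLp (MvPolynomial.pderiv i p) * φ x := by
  have e : ∀ x : Space d, fderiv ℝ (fun y : Space d => MvPolynomial.eval y.ofLp p) x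
      (EuclideanSpace.single i 1) = MvPolynomial.eval x.ofLp (MvPolynomial.pderiv i p) :=
    congrFun (partialDeriv_eval p i)
  have hint : ∀ (q : MvPolynomial (Fin d) ℝ) (ψ : Space d → ℝ), IsTestFunction ψ →
      Integrable fun x => MvPolynomial.eval x.ofLp q * ψ x := fun q ψ hψ =>
    ((continuous_eval q).mul hψ.continuous).integrable_of_hasCompactSupport hψ.2.mul_left
  have h1 := integral_mul_fderiv_eq_neg_fderiv_mul_of_integrable (𝕜 := ℝ) (μ := volume)
    (v := EuclideanSpace.single i 1) (by simpa only [e] using hint _ φ h)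
    (hint p _ (h.partialDeriv i)) (hint p φ h) (fun x _ => differentiable_eval p x)
    (fun x _ => (h.1.differentiable (by simp)) x)
  simp only [e] at h1
  exact h1

/-- Two weak gradients of the same function agree almost everywhere. -/
theorem IsWeakGradient.ae_eq {d : ℕ} {u : Space d → ℝ} {g g' : Space d → Space d}
    (h : IsWeakGradient u g) (h' : IsWeakGradient u g') : g =ᵐ[volume] g' := by
  have hloc : ∀ {g : Space d → Space d}, LocallyIntegrable g → ∀ i : Fin d,
      LocallyIntegrable fun x => g x i := fun {g} hg i x => by
    obtain ⟨s, hs, hi⟩ := hg x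
    exact ⟨s, hs, (EuclideanSpace.proj i : Space d →L[ℝ] ℝ).integrable_comp hi⟩
  have hcomp : ∀ i, (fun x => g x i) =ᵐ[volume] fun x => g' x i := fun i => by
    refine ae_eq_of_integral_contDiff_smul_eq (hloc h.locallyIntegrable_grad i)
      (hloc h'.locallyIntegrable_grad i) fun φ hφ hφ' => ?_
    have e := (h.integral_eq φ ⟨hφ, hφ'⟩ i).symm.trans (h'.integral_eq φ ⟨hφ, hφ'⟩ i)
    simpa only [smul_eq_mul, mul_comm, neg_inj] using e
  filter_upwards [ae_all_iff.2 hcomp] with x hx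
  ext i
  exact hx i

theorem fisherInformation_eq_of_isWeakGradient {d : ℕ} {u : Space d → ℝ} {g : Space d → Space d}
    (h : IsWeakGradient (fun x => u x / gaussian d x) g) :
    fisherInformation u = ∫⁻ x, ‖g x‖ₑ ^ 2 * ENNReal.ofReal (gaussian d x) := by
  refine le_antisymm (iInf₂_le g h) (le_iInf₂ fun g' h' => le_of_eq ?_)
  refine lintegral_congr_ae ((h.ae_eq h').mono fun x hx => ?_)
  simp only [hx]

theorem hasSum_add_single_iff {d : ℕ} {E : Type*} [AddCommMonoid E] [TopologicalSpace E]
    (j : Fin d) {g : (Fin d → ℕ) → E} (hg : ∀ α, α j = 0 → g α = 0) {a : E} :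
    HasSum (fun α : Fin d → ℕ => g (α + Pi.single j 1)) a ↔ HasSum g a := by
  refine (add_left_injective (Pi.single j 1 : Fin d → ℕ)).hasSum_iff fun α hα => hg α ?_
  by_contra h0
  exact hα ⟨α - Pi.single j 1, tsub_add_cancel_of_le (single_one_le h0)⟩

theorem summable_apply_mul {d : ℕ} {c : (Fin d → ℕ) → ℝ}
    (hs : Summable fun α => (order α : ℝ) * (multiFactorial α * c α ^ 2)) (i : Fin d) :
    Summable fun α => (α i : ℝ) * (multiFactorial α * c α ^ 2) := by
  refine Summable.of_nonneg_of_le (fun α => by positivity) (fun α => ?_) hs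
  gcongr
  exact Finset.single_le_sum (f := α) (fun _ _ => Nat.zero_le _) (Finset.mem_univ i)

/-- The `i`-th partial derivative of `u / f_∞` has the Hermite expansion
`∑ d_α αᵢ H_{α - eᵢ}`. -/
theorem exists_partialDeriv_coeff {d : ℕ} (u : WeightedL2 d)
    (hs : Summable fun α => (order α : ℝ) * (multiFactorial α * hermiteCoeff u α ^ 2))
    (i : Fin d) : ∃ w : WeightedL2 d,
      (∀ α, hermiteCoeff w α = (α i + 1) * hermiteCoeff u (α + Pi.single i 1)) ∧
      HasSum (fun α => (α i : ℝ) * (multiFactorial α * hermiteCoeff u α ^ 2)) (‖w‖ ^ 2) := by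
  let G : (Fin d → ℕ) → ℝ := fun α => (α i : ℝ) * (multiFactorial α * hermiteCoeff u α ^ 2)
  have hG0 : ∀ α, α i = 0 → G α = 0 := fun α h => by simp [G, h]
  have e : ∀ α, (multiFactorial α : ℝ) * ((α i + 1) * hermiteCoeff u (α + Pi.single i 1)) ^ 2
      = G (α + Pi.single i 1) := fun α => by
    simp only [G, multiFactorial_add_single, Pi.add_apply, Pi.single_eq_same]
    push_cast
    ring
  have hG := (hasSum_add_single_iff i hG0).2 (summable_apply_mul hs i).hasSum
  obtain ⟨w, hw⟩ := exists_hermiteCoeff_eq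
    (fun α => (α i + 1) * hermiteCoeff u (α + Pi.single i 1))
    (by simpa only [e] using hG.summable)
  refine ⟨w, hw, (hasSum_add_single_iff i hG0).1 ?_⟩
  have := hasSum_hermiteCoeff_sq w
  simpa only [hw, e] using this

theorem integral_mul_partialDeriv_eq {d : ℕ} {u w : WeightedL2 d} {i : Fin d}
    (hw : ∀ α, hermiteCoeff w α = (α i + 1) * hermiteCoeff u (α + Pi.single i 1))
    {φ : Space d → ℝ} (h : IsTestFunction φ) :
    ∫ x, u x / gaussian d x * partialDeriv i φ x = -∫ x, w x / gaussian d x * φ x := by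
  have hpair : ∀ (v : WeightedL2 d) {ψ : Space d → ℝ} (hψ : IsTestFunction ψ),
      ∫ x, v x / gaussian d x * ψ x = inner ℝ v (hψ.memLp.toLp _) := fun v ψ hψ => by
    rw [inner_toLp_mul_gaussian]
    refine integral_congr_ae (Eventually.of_forall fun x => ?_)
    simp only
    ring
  have hherm : ∀ (α : Fin d → ℕ) {ψ : Space d → ℝ} (hψ : IsTestFunction ψ),
      inner ℝ (hermite α) (hψ.memLp.toLp _)
        = ∫ x, MvPolynomial.eval x.ofLp (hermitePoly α) * ψ x := fun α ψ hψ => by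
    rw [← hpair _ hψ, hermite_eq]
    have := (memLp_eval_mul_gaussian (hermitePoly α)).coeFn_toLp
    rw [EventuallyEq, ae_invGaussianMeasure] at this
    refine integral_congr_ae (this.mono fun x hx => ?_)
    simp only [hx]
    rw [mul_div_cancel_right₀ _ (gaussian_pos d x).ne']
  -- Both sides are continuous linear in `u` and `w`, so it suffices to compare the Hermite
  -- expansions term by term; there the identity is integration by parts for polynomials.
  let G : (Fin d → ℕ) → ℝ := fun α => α i * (hermiteCoeff u α *
    inner ℝ (hermite (α - Pi.single i 1)) (h.memLp.toLp _))
  have h1 := (innerSL ℝ ((h.partialDeriv i).memLp.toLp _)).hasSum (hasSum_hermiteCoeff u)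
  have h2 := (innerSL ℝ (h.memLp.toLp _)).hasSum (hasSum_hermiteCoeff w)
  have h2' : HasSum G (inner ℝ w (h.memLp.toLp _)) := by
    refine (hasSum_add_single_iff i fun α h0 => by simp [G, h0]).1 ?_
    rw [real_inner_comm]
    refine h2.congr_fun fun α => ?_
    simp only [map_smul, innerSL_apply_apply, hw, G, Pi.add_apply,
      Pi.single_eq_same, add_tsub_cancel_right, smul_eq_mul, real_inner_comm]
    push_cast
    ring
  rw [hpair u (h.partialDeriv i), hpair w h, real_inner_comm]
  refine h1.unique (h2'.neg.congr_fun fun α => ?_)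
  simp only [map_smul, innerSL_apply_apply, smul_eq_mul, G,
    real_inner_comm (hermite _)]
  rw [hherm _ (h.partialDeriv i), hherm _ h, integral_eval_mul_partialDeriv _ h, pderiv_hermitePoly]
  simp only [MvPolynomial.smul_eval, mul_assoc]
  rw [integral_const_mul]
  ring

theorem locallyIntegrable_div_gaussian {d : ℕ} (u : WeightedL2 d) :
    LocallyIntegrable fun x => u x / gaussian d x := by
  have hc : Continuous fun x => (gaussian d x)⁻¹ :=
    (continuous_gaussian d).inv₀ fun x => (gaussian_pos d x).ne'
  simpa only [div_eq_mul_inv] using (integrable_coe u).locallyIntegrable.mul_continuous hc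

theorem lintegral_sq_div_gaussian {d : ℕ} (u : WeightedL2 d) :
    ∫⁻ x, ENNReal.ofReal ((u x / gaussian d x) ^ 2 * gaussian d x)
      = ENNReal.ofReal (‖u‖ ^ 2) := by
  rw [← real_inner_self_eq_norm_sq, L2.inner_def, integral_invGaussianMeasure,
    ofReal_integral_eq_lintegral_ofReal
      (integrable_invGaussianMeasure.1 (L2.integrable_inner (𝕜 := ℝ) u u))
      (Eventually.of_forall fun x => ?_)]
  · refine lintegral_congr fun x => ?_
    have := gaussian_pos d x
    simp only [RCLike.inner_apply, conj_trivial]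
    congr 1
    field_simp
  · have := gaussian_pos d x
    simp only [Pi.zero_apply, RCLike.inner_apply, conj_trivial]
    exact mul_nonneg (by positivity) (mul_self_nonneg _)

theorem fisherInformation_eq_tsum {d : ℕ} (u : WeightedL2 d)
    (hs : Summable fun α => (order α : ℝ) * (multiFactorial α * hermiteCoeff u α ^ 2)) :
    fisherInformation u = ENNReal.ofReal
      (∑' α, (order α : ℝ) * (multiFactorial α * hermiteCoeff u α ^ 2)) := by
  choose w hw hsum using exists_partialDeriv_coeff u hs
  let g : Space d → Space d := fun x => WithLp.toLp 2 fun i => w i x / gaussian d x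
  have hg : IsWeakGradient (fun x => u x / gaussian d x) g := by
    refine ⟨locallyIntegrable_div_gaussian u, ?_, fun φ hφ i =>
      integral_mul_partialDeriv_eq (hw i) hφ⟩
    have e : g = fun x => ∑ i, (w i x / gaussian d x) • EuclideanSpace.single i (1 : ℝ) := by
      funext x
      ext j
      simp [g, Pi.single_apply]
    rw [e]
    refine locallyIntegrable_finsetSum _ fun i _ x => ?_
    obtain ⟨s, hs, hi⟩ := locallyIntegrable_div_gaussian (w i) x
    exact ⟨s, hs, hi.smul_const _⟩
  have hm : ∀ i, Measurable fun x => ENNReal.ofReal ((w i x / gaussian d x) ^ 2 * gaussian d x) :=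
    fun i => ((((Lp.stronglyMeasurable (w i)).measurable.div
      (continuous_gaussian d).measurable).pow_const 2).mul
        (continuous_gaussian d).measurable).ennreal_ofReal
  have hpt : ∀ x, ‖g x‖ₑ ^ 2 * ENNReal.ofReal (gaussian d x)
      = ∑ i, ENNReal.ofReal ((w i x / gaussian d x) ^ 2 * gaussian d x) := fun x => by
    have h0 := gaussian_pos d x
    rw [← ENNReal.ofReal_sum_of_nonneg fun i _ => by positivity, ← Finset.sum_mul,
      ENNReal.ofReal_mul (Finset.sum_nonneg fun i _ => sq_nonneg _)]
    congr 1
    rw [← ofReal_norm, ← ENNReal.ofReal_pow (norm_nonneg _), EuclideanSpace.real_norm_sq_eq]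
  rw [fisherInformation_eq_of_isWeakGradient hg]
  simp only [hpt]
  rw [lintegral_finsetSum _ fun i _ => hm i]
  simp only [lintegral_sq_div_gaussian]
  rw [← ENNReal.ofReal_sum_of_nonneg fun i _ => sq_nonneg _]
  congr 1
  refine ((hasSum_sum fun i (_ : i ∈ Finset.univ) => hsum i).congr_fun fun α => ?_).tsum_eq.symm
  rw [← Finset.sum_mul, order]
  push_cast
  rfl

/-! ### Summation by order -/

theorem hasSum_order_eq {d : ℕ} {E : Type*} [AddCommMonoid E] [TopologicalSpace E]
    (F : (Fin d → ℕ) → E) (k : ℕ) :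
    HasSum (fun α : { α : Fin d → ℕ // order α = k } => F α) (∑ α ∈ multiIndices d k, F α) := by
  have h : HasSum (fun α : (multiIndices d k : Set (Fin d → ℕ)) => F α)
      (∑ α ∈ multiIndices d k, F α) := by exact (multiIndices d k).hasSum F
  refine (Equiv.hasSum_iff (Equiv.subtypeEquivRight fun α => ?_) (f := fun α :
    (multiIndices d k : Set (Fin d → ℕ)) => F α)).2 h
  exact (mem_multiIndices (α := α)).symm

/-- A convergent sum over multi-indices may be grouped by order. -/
theorem hasSum_sum_multiIndices {d : ℕ} {E : Type*} [AddCommMonoid E] [TopologicalSpace E]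
    [RegularSpace E] [ContinuousAdd E] {F : (Fin d → ℕ) → E} {a : E} (h : HasSum F a) :
    HasSum (fun k => ∑ α ∈ multiIndices d k, F α) a :=
  HasSum.sigma ((Equiv.sigmaFiberEquiv (order (d := d))).hasSum_iff.2 h) (hasSum_order_eq F)

theorem summable_of_summable_sum_multiIndices {d : ℕ} {F : (Fin d → ℕ) → ℝ} (h0 : ∀ α, 0 ≤ F α)
    (h : Summable fun k => ∑ α ∈ multiIndices d k, F α) : Summable F := by
  rw [← (Equiv.sigmaFiberEquiv (order (d := d))).summable_iff]
  refine (summable_sigma_of_nonneg fun _ => h0 _).2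
    ⟨fun k => (hasSum_order_eq F k).summable, h.congr fun k => ?_⟩
  exact (hasSum_order_eq F k).tsum_eq.symm

/-! ### The weak equation for polynomial test functions -/

theorem partialDeriv_add {d : ℕ} (i : Fin d) {u v : Space d → ℝ} (hu : Differentiable ℝ u)
    (hv : Differentiable ℝ v) :
    partialDeriv i (fun x => u x + v x) = fun x => partialDeriv i u x + partialDeriv i v x := by
  funext x
  simp only [partialDeriv]
  rw [fderiv_fun_add (hu x) (hv x)]
  rfl

theorem partialDeriv_mul {d : ℕ} (i : Fin d) {u v : Space d → ℝ} (hu : Differentiable ℝ u)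
    (hv : Differentiable ℝ v) :
    partialDeriv i (fun x => u x * v x)
      = fun x => partialDeriv i u x * v x + u x * partialDeriv i v x := by
  funext x
  simp only [partialDeriv]
  rw [fderiv_fun_mul (hu x) (hv x)]
  simp only [add_apply, smul_apply, smul_eq_mul]
  ring

theorem partialDeriv_comp_smul {d : ℕ} (i : Fin d) (c : ℝ) (u : Space d → ℝ) :
    partialDeriv i (fun x => u (c • x)) = fun x => c * partialDeriv i u (c • x) := by
  funext x
  simp only [partialDeriv]
  rw [fderiv_comp_smul]
  rfl

theorem partialDeriv_const_mul {d : ℕ} (i : Fin d) (c : ℝ) (u : Space d → ℝ) :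
    partialDeriv i (fun x => c * u x) = fun x => c * partialDeriv i u x := by
  funext x
  simp only [partialDeriv]
  have : fderiv ℝ (c • u) x = c • fderiv ℝ u x := congrFun (fderiv_const_smul_field c) x
  exact congrArg (fun A : Space d →L[ℝ] ℝ => A (EuclideanSpace.single i 1)) this

theorem partialDeriv_congr {d : ℕ} {u v : Space d → ℝ} {x : Space d}
    (h : u =ᶠ[nhds x] v) (i : Fin d) : partialDeriv i u =ᶠ[nhds x] partialDeriv i v :=
  (h.fderiv (𝕜 := ℝ)).mono fun y hy => by simp only [partialDeriv, hy]

theorem IsTestFunction.exists_abs_le {d : ℕ} {φ : Space d → ℝ} (h : IsTestFunction φ) :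
    ∃ K, ∀ x, |φ x| ≤ K :=
  h.continuous.bounded_above_of_compact_support h.2

theorem IsTestFunction.comp_smul {d : ℕ} {φ : Space d → ℝ} (h : IsTestFunction φ) {c : ℝ}
    (hc : c ≠ 0) : IsTestFunction fun x => φ (c • x) :=
  ⟨h.1.comp (contDiff_const_smul c), h.2.comp_smul hc⟩

/-- Cutoff functions that exhaust the space, with uniform bounds on their derivatives up to order
two. -/
theorem exists_cutoff (d : ℕ) : ∃ χ : ℕ → Space d → ℝ, (∀ n, IsTestFunction (χ n)) ∧
    (∀ x, ∀ᶠ n in atTop, χ n =ᶠ[nhds x] fun _ => 1) ∧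
    ∃ K, (∀ n x, |χ n x| ≤ K) ∧ (∀ i n x, |partialDeriv i (χ n) x| ≤ K) ∧
      ∀ i j n x, |partialDeriv i (partialDeriv j (χ n)) x| ≤ K := by
  let b : ContDiffBump (0 : Space d) := ⟨1, 2, by norm_num, by norm_num⟩
  have hb : IsTestFunction (b : Space d → ℝ) := ⟨b.contDiff, b.hasCompactSupport⟩
  let c : ℕ → ℝ := fun n => ((n : ℝ) + 1)⁻¹
  have hc0 : ∀ n, 0 < c n := fun n => by positivity
  have hc1 : ∀ n, c n ≤ 1 := fun n => inv_le_one_of_one_le₀ (by simp)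
  obtain ⟨K₀, hK₀⟩ := hb.exists_abs_le
  choose K₁ hK₁ using fun i => (hb.partialDeriv i).exists_abs_le
  choose K₂ hK₂ using fun i j => ((hb.partialDeriv j).partialDeriv i).exists_abs_le
  have h0 : 0 ≤ K₀ := (abs_nonneg _).trans (hK₀ 0)
  have h1 : ∀ i, 0 ≤ K₁ i := fun i => (abs_nonneg _).trans (hK₁ i 0)
  have h2 : ∀ i j, 0 ≤ K₂ i j := fun i j => (abs_nonneg _).trans (hK₂ i j 0)
  have s1 : ∀ i, K₁ i ≤ ∑ i, K₁ i := fun i =>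
    Finset.single_le_sum (fun i _ => h1 i) (Finset.mem_univ i)
  have s2 : ∀ i j, K₂ i j ≤ ∑ i, ∑ j, K₂ i j := fun i j =>
    (Finset.single_le_sum (fun j _ => h2 i j) (Finset.mem_univ j)).trans
      (Finset.single_le_sum (f := fun i => ∑ j, K₂ i j)
        (fun i _ => Finset.sum_nonneg fun j _ => h2 i j) (Finset.mem_univ i))
  have p1 : 0 ≤ ∑ i, K₁ i := Finset.sum_nonneg fun i _ => h1 i
  have p2 : 0 ≤ ∑ i, ∑ j, K₂ i j :=
    Finset.sum_nonneg fun i _ => Finset.sum_nonneg fun j _ => h2 i j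
  have hmul : ∀ n a, |c n * a| ≤ |a| := fun n a => by
    rw [abs_mul, abs_of_pos (hc0 n)]
    exact mul_le_of_le_one_left (abs_nonneg a) (hc1 n)
  refine ⟨fun n x => b (c n • x), fun n => hb.comp_smul (hc0 n).ne', fun x => ?_,
    K₀ + ∑ i, K₁ i + ∑ i, ∑ j, K₂ i j, fun n x => ?_, fun i n x => ?_, fun i j n x => ?_⟩
  · obtain ⟨N, hN⟩ := exists_nat_gt ‖x‖
    filter_upwards [eventually_ge_atTop N] with n hn
    have hx : x ∈ Metric.ball (0 : Space d) (n + 1) := by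
      have : (N : ℝ) ≤ n := by exact_mod_cast hn
      rw [mem_ball_zero_iff]
      linarith
    filter_upwards [Metric.isOpen_ball.mem_nhds hx] with y hy
    refine b.one_of_mem_closedBall ?_
    rw [mem_ball_zero_iff] at hy
    rw [mem_closedBall_zero_iff, norm_smul, Real.norm_of_nonneg (hc0 n).le]
    exact inv_mul_le_one_of_le₀ hy.le (by positivity)
  · linarith [hK₀ (c n • x)]
  · rw [partialDeriv_comp_smul]
    linarith [hmul n (partialDeriv i b (c n • x)), hK₁ i (c n • x), s1 i]
  · rw [partialDeriv_comp_smul, partialDeriv_const_mul, partialDeriv_comp_smul]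
    linarith [hmul n (c n * partialDeriv i (partialDeriv j b) (c n • x)),
      hmul n (partialDeriv i (partialDeriv j b) (c n • x)), hK₂ i j (c n • x), s2 i j]

/-- A family of functions dominated by one polynomial. -/
def PolyDominated {d : ℕ} (ψ : ℕ → Space d → ℝ) : Prop :=
  ∃ P : MvPolynomial (Fin d) ℝ, ∀ n x, |ψ n x| ≤ MvPolynomial.eval x.ofLp P

namespace PolyDominated

theorem eval {d : ℕ} (p : MvPolynomial (Fin d) ℝ) :
    PolyDominated fun _ (x : Space d) => MvPolynomial.eval x.ofLp p :=
  ⟨1 + p ^ 2, fun _ x => abs_eval_le_eval p x⟩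

theorem of_abs_le {d : ℕ} {ψ : ℕ → Space d → ℝ} {K : ℝ} (h : ∀ n x, |ψ n x| ≤ K) :
    PolyDominated ψ :=
  ⟨MvPolynomial.C K, fun n x => by simpa using h n x⟩

theorem add {d : ℕ} {ψ ψ' : ℕ → Space d → ℝ} (h : PolyDominated ψ) (h' : PolyDominated ψ') :
    PolyDominated fun n x => ψ n x + ψ' n x := by
  obtain ⟨P, hP⟩ := h
  obtain ⟨Q, hQ⟩ := h'
  refine ⟨P + Q, fun n x => (abs_add_le _ _).trans ?_⟩
  rw [map_add]
  exact add_le_add (hP n x) (hQ n x)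

theorem mul {d : ℕ} {ψ ψ' : ℕ → Space d → ℝ} (h : PolyDominated ψ) (h' : PolyDominated ψ') :
    PolyDominated fun n x => ψ n x * ψ' n x := by
  obtain ⟨P, hP⟩ := h
  obtain ⟨Q, hQ⟩ := h'
  refine ⟨P * Q, fun n x => ?_⟩
  rw [abs_mul, map_mul]
  exact mul_le_mul (hP n x) (hQ n x) (abs_nonneg _) ((abs_nonneg _).trans (hP n x))

theorem const {d : ℕ} (c : ℝ) : PolyDominated fun _ (_ : Space d) => c :=
  of_abs_le fun _ _ => le_rfl

theorem sub {d : ℕ} {ψ ψ' : ℕ → Space d → ℝ} (h : PolyDominated ψ) (h' : PolyDominated ψ') :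
    PolyDominated fun n x => ψ n x - ψ' n x := by
  have := h.add ((const (-1)).mul h')
  simpa [sub_eq_add_neg] using this

theorem sum {d : ℕ} {ι : Type*} (s : Finset ι) {ψ : ι → ℕ → Space d → ℝ}
    (h : ∀ i, PolyDominated (ψ i)) : PolyDominated fun n x => ∑ i ∈ s, ψ i n x := by
  classical
  induction s using Finset.induction_on with
  | empty => simpa using const 0
  | insert i s hi ih =>
    simp only [Finset.sum_insert hi]
    exact (h i).add ih

/-- Pointwise convergence under a polynomial bound implies convergence of the pairings,
uniformly on bounded subsets of `L²(f_∞⁻¹)`. -/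
theorem exists_integral_sub_le {d : ℕ} {ψ : ℕ → Space d → ℝ} {ψ₀ : Space d → ℝ}
    (h : PolyDominated ψ) (hc : ∀ n, Continuous (ψ n)) (hc₀ : Continuous ψ₀)
    (hlim : ∀ x, Tendsto (fun n => ψ n x) atTop (nhds (ψ₀ x))) :
    ∃ ε : ℕ → ℝ, Tendsto ε atTop (nhds 0) ∧
      ∀ n (u : WeightedL2 d), |(∫ x, u x * ψ n x) - ∫ x, u x * ψ₀ x| ≤ ‖u‖ * ε n := by
  obtain ⟨P, hP⟩ := h
  have hP₀ : ∀ x, |ψ₀ x| ≤ MvPolynomial.eval x.ofLp P := fun x =>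
    le_of_tendsto (hlim x).abs (Eventually.of_forall fun n => hP n x)
  have hd : ∀ n x, |ψ n x - ψ₀ x| ≤ MvPolynomial.eval x.ofLp (2 * P) := fun n x => by
    have := abs_sub (ψ n x) (ψ₀ x)
    simp only [map_mul, map_ofNat]
    linarith [hP n x, hP₀ x]
  have hm : ∀ n, MemLp (fun x => (ψ n x - ψ₀ x) * gaussian d x) 2 (invGaussianMeasure d) :=
    fun n => memLp_mul_gaussian_of_le ((hc n).sub hc₀).aestronglyMeasurable _ (hd n)
  refine ⟨fun n => ‖(hm n).toLp _‖, ?_, fun n u => ?_⟩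
  · have hsq : Tendsto (fun n => ∫ x, (ψ n x - ψ₀ x) ^ 2 * gaussian d x) atTop
        (nhds (∫ _ : Space d, (0 : ℝ))) := by
      refine tendsto_integral_of_dominated_convergence
        (fun x => MvPolynomial.eval x.ofLp ((2 * P) ^ 2) * gaussian d x) (fun n =>
          ((((hc n).sub hc₀).pow 2).mul (continuous_gaussian d)).aestronglyMeasurable)
        (integrable_eval_mul_gaussian _) (fun n => Eventually.of_forall fun x => ?_)
        (Eventually.of_forall fun x => ?_)
      · rw [norm_mul, Real.norm_of_nonneg (gaussian_pos d x).le, norm_pow, Real.norm_eq_abs,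
          map_pow]
        have := (gaussian_pos d x).le
        gcongr
        exact hd n x
      · have := (((hlim x).sub_const (ψ₀ x)).pow 2).mul_const (gaussian d x)
        simpa using this
    have := hsq.sqrt
    simp only [← norm_sq_toLp_mul_gaussian (hm _), Real.sqrt_sq (norm_nonneg _), integral_zero,
      Real.sqrt_zero] at this
    exact this
  · have h1 := integrable_mul_of_memLp u
      (memLp_mul_gaussian_of_le (hc n).aestronglyMeasurable P (hP n))
    have h2 := integrable_mul_of_memLp u
      (memLp_mul_gaussian_of_le hc₀.aestronglyMeasurable P hP₀)
    rw [← integral_sub h1 h2]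
    simp only [← mul_sub]
    rw [← inner_toLp_mul_gaussian u (hm n)]
    exact abs_real_inner_le_norm _ _

end PolyDominated

theorem contDiff_eval {d : ℕ} (p : MvPolynomial (Fin d) ℝ) :
    ContDiff ℝ ∞ fun x : Space d => MvPolynomial.eval x.ofLp p := by
  induction p using MvPolynomial.induction_on with
  | C a => simpa using contDiff_const
  | add p q hp hq => simpa using hp.add hq
  | mul_X p j hp =>
    have : ContDiff ℝ ∞ fun x : Space d => x.ofLp j :=
      (EuclideanSpace.proj j : Space d →L[ℝ] ℝ).contDiff
    simpa using hp.mul this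

theorem continuous_dualOperator {d : ℕ} (C D : Matrix (Fin d) (Fin d) ℝ) {φ : Space d → ℝ}
    (h : ContDiff ℝ ∞ φ) : Continuous (dualOperator C D φ) := by
  unfold dualOperator
  refine Continuous.sub ?_ ?_
  · refine continuous_finsetSum _ fun i _ => continuous_finsetSum _ fun j _ => ?_
    exact continuous_const.mul (contDiff_partialDeriv (contDiff_partialDeriv h j) i).continuous
  · refine continuous_finsetSum _ fun i _ => Continuous.mul ?_ (contDiff_partialDeriv h i).continuous
    refine continuous_finsetSum _ fun j _ => continuous_const.mul ?_
    exact (EuclideanSpace.proj j : Space d →L[ℝ] ℝ).continuous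

theorem dualOperator_congr {d : ℕ} (C D : Matrix (Fin d) (Fin d) ℝ) {φ ψ : Space d → ℝ}
    {x : Space d} (h : φ =ᶠ[nhds x] ψ) : dualOperator C D φ x = dualOperator C D ψ x := by
  have h1 : ∀ i, partialDeriv i φ =ᶠ[nhds x] partialDeriv i ψ := fun i =>
    partialDeriv_congr h i
  have h2 : ∀ i j, partialDeriv i (partialDeriv j φ) x = partialDeriv i (partialDeriv j ψ) x :=
    fun i j => (partialDeriv_congr (h1 j) i).eq_of_nhds
  simp only [dualOperator, h2, (h1 _).eq_of_nhds]

theorem polyDominated_dualOperator {d : ℕ} (C D : Matrix (Fin d) (Fin d) ℝ)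
    (p : MvPolynomial (Fin d) ℝ) {χ : ℕ → Space d → ℝ} (hχ : ∀ n, IsTestFunction (χ n)) {K : ℝ}
    (h0 : ∀ n x, |χ n x| ≤ K) (h1 : ∀ i n x, |partialDeriv i (χ n) x| ≤ K)
    (h2 : ∀ i j n x, |partialDeriv i (partialDeriv j (χ n)) x| ≤ K) :
    PolyDominated fun n => dualOperator C D fun x => MvPolynomial.eval x.ofLp p * χ n x := by
  have hdiff : ∀ {φ : Space d → ℝ}, IsTestFunction φ → Differentiable ℝ φ :=
    fun h => h.1.differentiable (by simp)
  have e1 : ∀ i n, partialDeriv i (fun x => MvPolynomial.eval x.ofLp p * χ n x)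
      = fun x => MvPolynomial.eval x.ofLp (MvPolynomial.pderiv i p) * χ n x
        + MvPolynomial.eval x.ofLp p * partialDeriv i (χ n) x := fun i n => by
    rw [partialDeriv_mul i (differentiable_eval p) (hdiff (hχ n)), partialDeriv_eval]
  have e2 : ∀ i j n, partialDeriv i (partialDeriv j
      (fun x => MvPolynomial.eval x.ofLp p * χ n x))
      = fun x => (MvPolynomial.eval x.ofLp (MvPolynomial.pderiv i (MvPolynomial.pderiv j p))
          * χ n x + MvPolynomial.eval x.ofLp (MvPolynomial.pderiv j p) * partialDeriv i (χ n) x)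
        + (MvPolynomial.eval x.ofLp (MvPolynomial.pderiv i p) * partialDeriv j (χ n) x
        + MvPolynomial.eval x.ofLp p * partialDeriv i (partialDeriv j (χ n)) x) := fun i j n => by
    have hj := hdiff ((hχ n).partialDeriv j)
    rw [e1, partialDeriv_add i ((differentiable_eval _).fun_mul (hdiff (hχ n)))
      ((differentiable_eval p).fun_mul hj),
      partialDeriv_mul i (differentiable_eval _) (hdiff (hχ n)),
      partialDeriv_mul i (differentiable_eval p) hj, partialDeriv_eval, partialDeriv_eval]
  have b0 := PolyDominated.of_abs_le h0
  have b1 := fun i => PolyDominated.of_abs_le (h1 i)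
  have b2 := fun i j => PolyDominated.of_abs_le (h2 i j)
  have bX : ∀ j : Fin d, PolyDominated fun _ (x : Space d) => x.ofLp j := fun j => by
    simpa using PolyDominated.eval (MvPolynomial.X j : MvPolynomial (Fin d) ℝ)
  unfold dualOperator
  simp only [e2]
  simp only [e1]
  exact (PolyDominated.sum _ fun i => PolyDominated.sum _ fun j => (PolyDominated.const _).mul
      ((((PolyDominated.eval _).mul b0).add ((PolyDominated.eval _).mul (b1 i))).add
        (((PolyDominated.eval _).mul (b1 j)).add ((PolyDominated.eval _).mul (b2 i j))))).sub
    (PolyDominated.sum _ fun i =>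
      (PolyDominated.sum _ fun j => (PolyDominated.const _).mul (bX j)).mul
        (((PolyDominated.eval _).mul b0).add ((PolyDominated.eval _).mul (b1 i))))

/-- The weak equation extends from test functions to polynomials. -/
theorem IsSolution.hasDerivAt_integral_mul_eval {d : ℕ} {C D : Matrix (Fin d) (Fin d) ℝ}
    {f₀ : WeightedL2 d} {f : ℝ → WeightedL2 d} (hf : IsSolution C D f₀ f)
    (p : MvPolynomial (Fin d) ℝ) {t : ℝ} (ht : 0 < t) :
    HasDerivAt (fun s => ∫ x, f s x * MvPolynomial.eval x.ofLp p)
      (∫ x, f t x * dualOperator C D (fun x => MvPolynomial.eval x.ofLp p) x) t := by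
  obtain ⟨χ, hχ, hχ1, K, h0, h1, h2⟩ := exists_cutoff d
  have hφ : ∀ n, IsTestFunction fun x => MvPolynomial.eval x.ofLp p * χ n x := fun n =>
    ⟨(contDiff_eval p).mul (hχ n).1, (hχ n).2.mul_left⟩
  have hev : ∀ x, ∀ᶠ n in atTop, (fun x => MvPolynomial.eval x.ofLp p * χ n x)
      =ᶠ[nhds x] fun x => MvPolynomial.eval x.ofLp p := fun x =>
    (hχ1 x).mono fun n hn => hn.mono fun y hy => by simp only [hy, mul_one]
  obtain ⟨ε, hε, hεb⟩ := ((PolyDominated.eval p).mul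
    (PolyDominated.of_abs_le h0)).exists_integral_sub_le
    (fun n => (hφ n).continuous) (continuous_eval p) (fun x =>
      tendsto_const_nhds.congr' ((hev x).mono fun n hn => hn.eq_of_nhds.symm))
  obtain ⟨ε', hε', hεb'⟩ := (polyDominated_dualOperator C D p hχ h0 h1 h2).exists_integral_sub_le
    (fun n => continuous_dualOperator C D (hφ n).1) (continuous_dualOperator C D (contDiff_eval p))
    (fun x => tendsto_const_nhds.congr' ((hev x).mono fun n hn => (dualOperator_congr C D hn).symm))
  obtain ⟨M, hM⟩ := (isCompact_Icc (a := (0 : ℝ)) (b := t + 1)).exists_bound_of_continuousOn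
    (hf.continuousOn.mono Icc_subset_Ici_self)
  refine hasDerivAt_of_tendstoUniformlyOn (l := atTop) (s := Ioo 0 (t + 1)) isOpen_Ioo
    (f := fun n s => ∫ x, f s x * (MvPolynomial.eval x.ofLp p * χ n x))
    (f' := fun n s => ∫ x, f s x *
      dualOperator C D (fun x => MvPolynomial.eval x.ofLp p * χ n x) x)
    (g' := fun s => ∫ x, f s x * dualOperator C D (fun x => MvPolynomial.eval x.ofLp p) x)
    ?_ (Eventually.of_forall fun n s hs => hf.equation _ (hφ n) s hs.1) ?_ ⟨ht, by linarith⟩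
  · rw [Metric.tendstoUniformlyOn_iff]
    intro η hη
    have hlim : Tendsto (fun n => M * ε' n) atTop (nhds 0) := by simpa using hε'.const_mul M
    have hlim' : Tendsto (fun n => |M * ε' n|) atTop (nhds 0) := by simpa using hlim.abs
    filter_upwards [hlim'.eventually_lt_const hη] with n hn s hs
    rw [dist_comm, Real.dist_eq]
    have hb := hεb' n (f s)
    have hMs := hM s ⟨hs.1.le, hs.2.le⟩
    refine lt_of_le_of_lt (hb.trans ?_) hn
    calc ‖f s‖ * ε' n ≤ ‖f s‖ * |ε' n| := by gcongr; exact le_abs_self _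
      _ ≤ |M| * |ε' n| := by gcongr; exact hMs.trans (le_abs_self _)
      _ = |M * ε' n| := (abs_mul _ _).symm
  · intro s hs
    rw [tendsto_iff_dist_tendsto_zero]
    refine squeeze_zero (fun _ => dist_nonneg) (fun n => ?_) (by simpa using hε.const_mul ‖f s‖)
    rw [Real.dist_eq]
    exact hεb n (f s)

/-- On polynomials, the dual operator is `-∑ C_ij a_j† ∂ᵢ`; here the normalisation
`D = (C + Cᵀ) / 2` enters. -/
theorem dualOperator_eval {d : ℕ} {C D : Matrix (Fin d) (Fin d) ℝ}
    (hD : D = (1 / 2 : ℝ) • (C + C.transpose)) (p : MvPolynomial (Fin d) ℝ) (x : Space d) :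
    dualOperator C D (fun x => MvPolynomial.eval x.ofLp p) x
      = -∑ i, ∑ j, C i j * MvPolynomial.eval x.ofLp (creation j (MvPolynomial.pderiv i p)) := by
  have hsymm : ∑ i, ∑ j, C j i *
        MvPolynomial.eval x.ofLp (MvPolynomial.pderiv i (MvPolynomial.pderiv j p))
      = ∑ i, ∑ j, C i j *
        MvPolynomial.eval x.ofLp (MvPolynomial.pderiv i (MvPolynomial.pderiv j p)) := by
    rw [Finset.sum_comm]
    simp only [pderiv_pderiv_comm]
  have hsum : ∑ i, ∑ j, D i j *
        MvPolynomial.eval x.ofLp (MvPolynomial.pderiv i (MvPolynomial.pderiv j p))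
      = ∑ i, ∑ j, C i j *
        MvPolynomial.eval x.ofLp (MvPolynomial.pderiv i (MvPolynomial.pderiv j p)) := by
    subst hD
    simp only [Matrix.smul_apply, Matrix.add_apply, Matrix.transpose_apply, smul_eq_mul, mul_add,
      add_mul, Finset.sum_add_distrib, mul_assoc, ← Finset.mul_sum]
    rw [hsymm]
    ring
  unfold dualOperator
  simp only [partialDeriv_eval]
  rw [hsum, ← Finset.sum_sub_distrib, ← Finset.sum_neg_distrib]
  refine Finset.sum_congr rfl fun i _ => ?_
  rw [Finset.sum_mul, ← Finset.sum_sub_distrib, ← Finset.sum_neg_distrib]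
  refine Finset.sum_congr rfl fun j _ => ?_
  rw [creation_apply, map_sub, map_mul, MvPolynomial.eval_X, pderiv_pderiv_comm i j]
  ring

/-- The Hermite coefficients of a solution satisfy a linear system of differential equations that
couples only multi-indices of the same order. -/
theorem IsSolution.hasDerivAt_inner_hermite {d : ℕ} {C D : Matrix (Fin d) (Fin d) ℝ}
    (hD : D = (1 / 2 : ℝ) • (C + C.transpose))
    {f₀ : WeightedL2 d} {f : ℝ → WeightedL2 d} (hf : IsSolution C D f₀ f)
    (α : Fin d → ℕ) {t : ℝ} (ht : 0 < t) :
    HasDerivAt (fun s => inner ℝ (f s) (hermite α))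
      (-∑ i, (α i : ℝ) * ∑ j, C i j *
        inner ℝ (f t) (hermite (α - Pi.single i 1 + Pi.single j 1))) t := by
  simp only [inner_hermite]
  convert hf.hasDerivAt_integral_mul_eval (hermitePoly α) ht using 1
  have e : ∀ x : Space d, f t x * dualOperator C D
      (fun x => MvPolynomial.eval x.ofLp (hermitePoly α)) x
      = -∑ i, ∑ j, (α i : ℝ) * (C i j * (f t x * MvPolynomial.eval x.ofLp
        (hermitePoly (α - Pi.single i 1 + Pi.single j 1)))) := fun x => by
    rw [dualOperator_eval hD, mul_neg, Finset.mul_sum]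
    congr 1
    refine Finset.sum_congr rfl fun i _ => ?_
    rw [Finset.mul_sum]
    refine Finset.sum_congr rfl fun j _ => ?_
    rw [pderiv_hermitePoly, map_smul, ← hermitePoly_add_single, MvPolynomial.smul_eval]
    ring
  simp only [e]
  rw [integral_neg, integral_finsetSum]
  · congr 1
    refine Finset.sum_congr rfl fun i _ => ?_
    rw [integral_finsetSum]
    · simp only [integral_const_mul, Finset.mul_sum]
    · exact fun j _ => ((integrable_mul_eval _ _).const_mul _).const_mul _
  · exact fun i _ => integrable_finsetSum _ fun j _ =>
      ((integrable_mul_eval _ _).const_mul _).const_mul _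

/-! ### Strict contraction of the drift flow -/

/-- The semigroup `exp (-tC)` on Euclidean space. -/
def driftFlow {d : ℕ} (C : Matrix (Fin d) (Fin d) ℝ) (t : ℝ) : Space d →L[ℝ] Space d :=
  NormedSpace.exp (t • -Matrix.toEuclideanCLM (𝕜 := ℝ) C)

theorem driftFlow_zero {d : ℕ} (C : Matrix (Fin d) (Fin d) ℝ) : driftFlow C 0 = 1 := by
  simp [driftFlow]

theorem exp_smul_mul_exp_neg_smul {A : Type*} [NormedRing A] [NormedAlgebra ℝ A]
    [CompleteSpace A] (x : A) (t : ℝ) :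
    NormedSpace.exp (t • x) * NormedSpace.exp ((-t) • x) = 1 := by
  let _ : NormedAlgebra ℚ A := NormedAlgebra.restrictScalars ℚ ℝ A
  rw [neg_smul, ← NormedSpace.exp_add_of_commute (Commute.refl _).neg_right, add_neg_cancel,
    NormedSpace.exp_zero]

theorem driftFlow_mul_driftFlow_neg {d : ℕ} (C : Matrix (Fin d) (Fin d) ℝ) (t : ℝ) :
    driftFlow C t * driftFlow C (-t) = 1 :=
  exp_smul_mul_exp_neg_smul (A := Space d →L[ℝ] Space d) _ t

theorem hasDerivAt_driftFlow {d : ℕ} (C : Matrix (Fin d) (Fin d) ℝ) (t : ℝ) :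
    HasDerivAt (driftFlow C) (driftFlow C t * -Matrix.toEuclideanCLM (𝕜 := ℝ) C) t :=
  hasDerivAt_exp_smul_const (𝔸 := Space d →L[ℝ] Space d) (-Matrix.toEuclideanCLM (𝕜 := ℝ) C) t

theorem hasDerivAt_driftFlow' {d : ℕ} (C : Matrix (Fin d) (Fin d) ℝ) (t : ℝ) :
    HasDerivAt (driftFlow C) (-Matrix.toEuclideanCLM (𝕜 := ℝ) C * driftFlow C t) t :=
  hasDerivAt_exp_smul_const' (𝔸 := Space d →L[ℝ] Space d) (-Matrix.toEuclideanCLM (𝕜 := ℝ) C) t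

theorem hasDerivAt_driftFlow_apply {d : ℕ} (C : Matrix (Fin d) (Fin d) ℝ) (v : Space d) (t : ℝ) :
    HasDerivAt (fun s => driftFlow C s v)
      (-Matrix.toEuclideanCLM (𝕜 := ℝ) C (driftFlow C t v)) t := by
  simpa using (hasDerivAt_driftFlow' C t).clm_apply (hasDerivAt_const t v)

theorem hasDerivAt_norm_sq_driftFlow {d : ℕ} {C D : Matrix (Fin d) (Fin d) ℝ}
    (hD : D = (1 / 2 : ℝ) • (C + C.transpose)) (v : Space d) (t : ℝ) :
    HasDerivAt (fun s => ‖driftFlow C s v‖ ^ 2)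
      (-2 * ((driftFlow C t v).ofLp ⬝ᵥ D.mulVec (driftFlow C t v).ofLp)) t := by
  convert (hasDerivAt_driftFlow_apply C v t).norm_sq using 1
  set y := driftFlow C t v
  have h1 : inner ℝ y (Matrix.toEuclideanCLM (𝕜 := ℝ) C y) = y.ofLp ⬝ᵥ C.mulVec y.ofLp := by
    rw [real_inner_comm, EuclideanSpace.inner_eq_star_dotProduct, Matrix.ofLp_toEuclideanCLM]
    simp
  have h2 : y.ofLp ⬝ᵥ C.transpose.mulVec y.ofLp = y.ofLp ⬝ᵥ C.mulVec y.ofLp := by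
    rw [Matrix.mulVec_transpose, dotProduct_comm, ← Matrix.dotProduct_mulVec]
  rw [inner_neg_right, h1, hD, Matrix.smul_mulVec, Matrix.add_mulVec, dotProduct_smul,
    dotProduct_add, h2, smul_eq_mul]
  ring

/-- The set of initial data along whose trajectories no energy is dissipated up to time `t` is a
`Cᵀ`-invariant subspace of `ker D`, hence trivial. -/
theorem eq_zero_of_mulVec_driftFlow_eq_zero {d : ℕ} {C D : Matrix (Fin d) (Fin d) ℝ}
    (hCD : IsNormalised C D) {t : ℝ} (ht : 0 < t) {v : Space d}
    (hv : ∀ s ∈ Ioo 0 t, D.mulVec (driftFlow C s v).ofLp = 0) : v = 0 := by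
  let A := Matrix.toEuclideanCLM (𝕜 := ℝ) C
  let B := Matrix.toEuclideanCLM (𝕜 := ℝ) D
  have hB : ∀ y : Space d, D.mulVec y.ofLp = 0 ↔ B y = 0 := fun y => by
    rw [← Matrix.ofLp_toEuclideanCLM, WithLp.ofLp_eq_zero]
  -- The open interval makes invariance of `W` a matter of differentiating in `s`; the endpoint
  -- `s = 0`, which gives `W ≤ ker D`, is recovered by continuity.
  let W : Submodule ℝ (Fin d → ℝ) :=
    { carrier := {w | ∀ s ∈ Ioo 0 t, B (driftFlow C s (WithLp.toLp 2 w)) = 0}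
      add_mem' := fun {a b} ha hb s hs => by
        rw [WithLp.toLp_add, map_add, map_add, ha s hs, hb s hs, add_zero]
      zero_mem' := fun s _ => by simp
      smul_mem' := fun c a ha s hs => by
        rw [WithLp.toLp_smul, map_smul, map_smul, ha s hs, smul_zero] }
  have hker : ∀ w ∈ W, D.mulVec w = 0 := fun w hw => by
    rw [show w = (WithLp.toLp 2 w : Space d).ofLp from rfl, hB]
    have hc : Tendsto (fun s => B (driftFlow C s (WithLp.toLp 2 w))) (nhdsWithin 0 (Ioi 0))
        (nhds (B (driftFlow C 0 (WithLp.toLp 2 w)))) :=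
      ((B.continuous.tendsto _).comp
        (hasDerivAt_driftFlow_apply C (WithLp.toLp 2 w) 0).continuousAt.tendsto).mono_left
          nhdsWithin_le_nhds
    rw [driftFlow_zero] at hc
    refine tendsto_nhds_unique hc (tendsto_const_nhds.congr' ?_)
    filter_upwards [Ioo_mem_nhdsGT ht] with s hs using (hw s hs).symm
  have hC : ∀ w ∈ W, C.mulVec w ∈ W := fun w hw s hs => by
    have h1 : HasDerivAt (fun s => B (driftFlow C s (WithLp.toLp 2 w)))
        (B (driftFlow C s (-A (WithLp.toLp 2 w)))) s := by
      refine B.hasFDerivAt.comp_hasDerivAt s ?_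
      simpa [A] using (hasDerivAt_driftFlow C s).clm_apply (hasDerivAt_const s (WithLp.toLp 2 w))
    have h2 : HasDerivAt (fun s => B (driftFlow C s (WithLp.toLp 2 w))) 0 s := by
      refine (hasDerivAt_const s (0 : Space d)).congr_of_eventuallyEq ?_
      filter_upwards [isOpen_Ioo.mem_nhds hs] with r hr using hw r hr
    have h3 := h1.unique h2
    rw [map_neg, map_neg, neg_eq_zero] at h3
    rw [← Matrix.toEuclideanCLM_toLp]
    exact h3
  have hW := hCD.no_invariant_subspace W hker fun w hw => by
    have h0 := hker w hw
    rw [hCD.eq_symmetric_part, Matrix.smul_mulVec, Matrix.add_mulVec, smul_eq_zero] at h0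
    -- On `ker D` the matrix `C` is skew: `Cᵀ w = -C w`.
    rw [eq_neg_of_add_eq_zero_right (h0.resolve_left (by norm_num))]
    exact W.neg_mem (hC w hw)
  have hmem : v.ofLp ∈ W := fun s hs => by
    rw [WithLp.toLp_ofLp, ← hB]
    exact hv s hs
  rw [hW, Submodule.mem_bot, WithLp.ofLp_eq_zero] at hmem
  exact hmem

theorem norm_driftFlow_apply_lt {d : ℕ} {C D : Matrix (Fin d) (Fin d) ℝ}
    (hCD : IsNormalised C D) {t : ℝ} (ht : 0 < t) {v : Space d} (hv : v ≠ 0) :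
    ‖driftFlow C t v‖ < ‖v‖ := by
  have hder := hasDerivAt_norm_sq_driftFlow hCD.eq_symmetric_part v
  have hpos : ∀ s, 0 ≤ (driftFlow C s v).ofLp ⬝ᵥ D.mulVec (driftFlow C s v).ofLp := fun s => by
    simpa using hCD.posSemidef.dotProduct_mulVec_nonneg (driftFlow C s v).ofLp
  have hanti : Antitone fun s => ‖driftFlow C s v‖ ^ 2 := by
    refine antitone_of_deriv_nonpos (fun s => (hder s).differentiableAt) fun s => ?_
    rw [(hder s).deriv]
    linarith [hpos s]
  have h0 : ‖driftFlow C 0 v‖ = ‖v‖ := by rw [driftFlow_zero]; rfl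
  by_contra! hle
  refine hv (eq_zero_of_mulVec_driftFlow_eq_zero hCD ht fun s hs => ?_)
  have hconst : ∀ r ∈ Ioo 0 t, ‖driftFlow C r v‖ ^ 2 = ‖v‖ ^ 2 := fun r hr => by
    refine le_antisymm (by simpa [h0] using hanti hr.1.le) ?_
    exact (pow_le_pow_left₀ (norm_nonneg _) hle 2).trans (hanti hr.2.le)
  have hz : HasDerivAt (fun s => ‖driftFlow C s v‖ ^ 2) 0 s := by
    refine (hasDerivAt_const s (‖v‖ ^ 2)).congr_of_eventuallyEq ?_
    filter_upwards [isOpen_Ioo.mem_nhds hs] with r hr using hconst r hr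
  have he := (hder s).unique hz
  refine (hCD.posSemidef.dotProduct_mulVec_zero_iff _).1 ?_
  simp only [star_trivial]
  linarith

theorem norm_driftFlow_lt_one {d : ℕ} {C D : Matrix (Fin d) (Fin d) ℝ}
    (hCD : IsNormalised C D) {t : ℝ} (ht : 0 < t) : ‖driftFlow C t‖ < 1 := by
  obtain ⟨x, hx, hmax⟩ := (isCompact_closedBall (0 : Space d) 1).exists_isMaxOn
    ⟨0, by simp⟩ (driftFlow C t).continuous.norm.continuousOn
  have hlt : ‖driftFlow C t x‖ < 1 := by
    rcases eq_or_ne x 0 with rfl | h0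
    · simp
    · exact (norm_driftFlow_apply_lt hCD ht h0).trans_le (by simpa using hx)
  refine lt_of_le_of_lt
    (ContinuousLinearMap.opNorm_le_of_unit_norm (norm_nonneg _) fun y hy => ?_) hlt
  exact hmax (by simp [hy])

/-! ### The flow on tensors -/

theorem sum_fin_cons {d k : ℕ} (F : (Fin (k + 1) → Fin d) → ℝ) :
    ∑ I, F I = ∑ J : Fin k → Fin d, ∑ j, F (Fin.cons j J) := by
  rw [← (Fin.consEquiv fun _ : Fin (k + 1) => Fin d).sum_comp F, Fintype.sum_prod_type_right]
  rfl

/-- If a curve of `k`-tensors solves `T' = -∑_r C^(r) T`, where `C^(r)` is the action of `C` on the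
`r`-th slot, then `T(t)` is the image of `T(0)` under the `k`-th tensor power of `exp (-tC)`, and so
its norm has decreased by the factor `‖exp (-tC)‖ ^ k`. The proof undoes the flow in one slot at a
time. -/
theorem sum_sq_tensor_le {d : ℕ} (C : Matrix (Fin d) (Fin d) ℝ) {t : ℝ} (ht : 0 < t) (k : ℕ)
    (T : ℝ → (Fin k → Fin d) → ℝ) (hc : ∀ I, ContinuousOn (fun s => T s I) (Icc 0 t))
    (hT : ∀ s ∈ Ioo 0 t, ∀ I, HasDerivAt (fun s => T s I)
      (-∑ r, ∑ l, C (I r) l * T s (Function.update I r l)) s) :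
    ∑ I, T t I ^ 2 ≤ (‖driftFlow C t‖ ^ 2) ^ k * ∑ I, T 0 I ^ 2 := by
  induction k with
  | zero =>
    rw [pow_zero, one_mul]
    refine le_of_eq (Finset.sum_congr rfl fun I _ => ?_)
    obtain ⟨s, hs, h⟩ := exists_hasDerivAt_eq_slope _ _ ht (hc I) fun s hs => hT s hs I
    simp only [Finset.univ_eq_empty, Finset.sum_empty, neg_zero, sub_zero] at h
    rw [eq_comm, div_eq_zero_iff, sub_eq_zero] at h
    rw [h.resolve_right ht.ne']
  | succ k ih =>
    let A := Matrix.toEuclideanCLM (𝕜 := ℝ) C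
    -- `V s J` is the column of `T s` in the first slot, and `U s J` the same column with the flow
    -- undone, so that `U` satisfies the equation for `k`-tensors.
    let V : ℝ → (Fin k → Fin d) → Space d := fun s J => WithLp.toLp 2 fun j => T s (Fin.cons j J)
    let U : ℝ → (Fin k → Fin d) → Space d := fun s J => driftFlow C (-s) (V s J)
    have hflow : ∀ s, HasDerivAt (fun s => driftFlow C (-s)) (driftFlow C (-s) * A) s := fun s => by
      refine ((hasDerivAt_driftFlow C (-s)).scomp s (hasDerivAt_neg s)).congr_deriv ?_
      ext
      simp [A]
    have hV : ∀ s ∈ Ioo 0 t, ∀ J, HasDerivAt (fun s => V s J)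
        (-A (V s J) - ∑ r, ∑ l, C (J r) l • V s (Function.update J r l)) s := fun s hs J => by
      have h1 : HasDerivAt (fun s => fun j => T s (Fin.cons j J)) _ s :=
        hasDerivAt_pi.2 fun j => hT s hs (Fin.cons j J)
      have h2 := (PiLp.hasFDerivAt_toLp (𝕜 := ℝ) 2 _).comp_hasDerivAt s h1
      refine h2.congr_deriv ?_
      ext j
      have hA : (A (V s J)).ofLp j = ∑ l, C j l * T s (Fin.cons l J) := by
        change (Matrix.toEuclideanCLM (𝕜 := ℝ) C _).ofLp j = _
        rw [Matrix.ofLp_toEuclideanCLM]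
        rfl
      simp only [Fin.sum_univ_succ, Fin.cons_zero, Fin.cons_succ, Fin.update_cons_zero,
        ← Fin.cons_update, PiLp.sub_apply, PiLp.neg_apply, hA, WithLp.ofLp_sum, Finset.sum_apply,
        PiLp.smul_apply, smul_eq_mul, V]
      simp [sub_eq_add_neg, add_comm]
    have hU : ∀ s ∈ Ioo 0 t, ∀ J, HasDerivAt (fun s => U s J)
        (-∑ r, ∑ l, C (J r) l • U s (Function.update J r l)) s := fun s hs J => by
      refine ((hflow s).clm_apply (hV s hs J)).congr_deriv ?_
      simp [U, map_sum, sub_eq_add_neg]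
    have hVc : ∀ J, ContinuousOn (fun s => V s J) (Icc 0 t) := fun J =>
      (PiLp.continuous_toLp 2 _).comp_continuousOn (continuousOn_pi.2 fun j => hc _)
    have hUc : ∀ J, ContinuousOn (fun s => U s J) (Icc 0 t) := fun J =>
      ContinuousOn.clm_apply (fun s _ => (hflow s).continuousAt.continuousWithinAt) (hVc J)
    have hi : ∀ i, ∑ J, U t J i ^ 2 ≤ (‖driftFlow C t‖ ^ 2) ^ k * ∑ J, U 0 J i ^ 2 := fun i => by
      let π := (EuclideanSpace.proj i : Space d →L[ℝ] ℝ)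
      refine ih (fun s J => U s J i) (fun J => π.continuous.comp_continuousOn (hUc J))
        fun s hs J => ?_
      refine (π.hasFDerivAt.comp_hasDerivAt s (hU s hs J)).congr_deriv ?_
      simp [π]
    have hsq : ∀ y : Space d, ∑ i, y i ^ 2 = ‖y‖ ^ 2 := fun y =>
      (EuclideanSpace.real_norm_sq_eq y).symm
    have hUV : ∀ J, ‖V t J‖ ^ 2 ≤ ‖driftFlow C t‖ ^ 2 * ‖U t J‖ ^ 2 := fun J => by
      have : V t J = driftFlow C t (U t J) := by
        change _ = (driftFlow C t * driftFlow C (-t)) (V t J)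
        rw [driftFlow_mul_driftFlow_neg]
        rfl
      rw [this, ← mul_pow]
      gcongr
      exact (driftFlow C t).le_opNorm _
    have hU0 : ∀ J, U 0 J = V 0 J := fun J => by
      simp only [U, neg_zero, driftFlow_zero]
      rfl
    have hTV : ∀ s, ∑ I, T s I ^ 2 = ∑ J, ‖V s J‖ ^ 2 := fun s => by
      rw [sum_fin_cons]
      exact Finset.sum_congr rfl fun J _ => hsq (V s J)
    calc ∑ I, T t I ^ 2 = ∑ J, ‖V t J‖ ^ 2 := hTV t
      _ ≤ ∑ J, ‖driftFlow C t‖ ^ 2 * ‖U t J‖ ^ 2 := Finset.sum_le_sum fun J _ => hUV J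
      _ = ‖driftFlow C t‖ ^ 2 * ∑ i, ∑ J, U t J i ^ 2 := by
        rw [← Finset.mul_sum, Finset.sum_comm]
        simp only [hsq]
      _ ≤ ‖driftFlow C t‖ ^ 2 * ∑ i, (‖driftFlow C t‖ ^ 2) ^ k * ∑ J, U 0 J i ^ 2 := by
        gcongr with i
        exact hi i
      _ = (‖driftFlow C t‖ ^ 2) ^ (k + 1) * ∑ I, T 0 I ^ 2 := by
        rw [← Finset.mul_sum, Finset.sum_comm, hTV]
        simp only [hsq, hU0]
        ring

/-! ### Multi-indices counting the entries of an index tuple -/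

/-- The multi-index that counts how often each value occurs in the tuple `I`. -/
def countIndex {d k : ℕ} (I : Fin k → Fin d) : Fin d → ℕ := ∑ r, Pi.single (I r) 1

theorem countIndex_cons {d k : ℕ} (j : Fin d) (J : Fin k → Fin d) :
    countIndex (Fin.cons j J : Fin (k + 1) → Fin d) = countIndex J + Pi.single j 1 := by
  simp [countIndex, Fin.sum_univ_succ, add_comm]

theorem countIndex_update {d k : ℕ} (I : Fin k → Fin d) (r : Fin k) (l : Fin d) :
    countIndex (Function.update I r l) = countIndex I - Pi.single (I r) 1 + Pi.single l 1 := by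
  unfold countIndex
  rw [← Finset.add_sum_erase _ _ (Finset.mem_univ r),
    ← Finset.add_sum_erase _ (fun r => Pi.single (I r) 1) (Finset.mem_univ r),
    add_tsub_cancel_left, Function.update_self, add_comm]
  congr 1
  refine Finset.sum_congr rfl fun s hs => ?_
  rw [Function.update_of_ne (Finset.ne_of_mem_erase hs)]

theorem sum_countIndex_mul {d k : ℕ} (I : Fin k → Fin d) (g : Fin d → ℝ) :
    ∑ i, (countIndex I i : ℝ) * g i = ∑ r, g (I r) := by
  simp only [countIndex, Finset.sum_apply, Nat.cast_sum, Finset.sum_mul]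
  rw [Finset.sum_comm]
  refine Finset.sum_congr rfl fun r _ => ?_
  simp [Pi.single_apply]

theorem sum_multiIndices_add_single {d k : ℕ} (j : Fin d) {G : (Fin d → ℕ) → ℝ}
    (hG : ∀ α, α j = 0 → G α = 0) :
    ∑ α ∈ multiIndices d k, G (α + Pi.single j 1) = ∑ β ∈ multiIndices d (k + 1), G β := by
  let e : (Fin d → ℕ) ↪ (Fin d → ℕ) :=
    ⟨fun α => α + Pi.single j 1, add_left_injective (Pi.single j 1 : Fin d → ℕ)⟩
  refine (Finset.sum_map (multiIndices d k) e G).symm.trans ?_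
  refine Finset.sum_subset (fun β hβ => ?_) fun β hβ hβ' => hG β ?_
  · obtain ⟨α, hα, rfl⟩ := Finset.mem_map.1 hβ
    rw [mem_multiIndices] at hα ⊢
    rw [← hα]
    exact order_add_single α j
  · by_contra h0
    have e : β - Pi.single j 1 + Pi.single j 1 = β := tsub_add_cancel_of_le (single_one_le h0)
    refine hβ' (Finset.mem_map.2 ⟨β - Pi.single j 1, ?_, e⟩)
    rw [mem_multiIndices] at hβ ⊢
    rw [← e, order_add_single] at hβ
    omega

/-- A multi-index `α` of order `k` counts the entries of `k! / α!` tuples. -/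
theorem sum_countIndex {d : ℕ} (k : ℕ) (F : (Fin d → ℕ) → ℝ) :
    ∑ I : Fin k → Fin d, F (countIndex I)
      = k.factorial * ∑ α ∈ multiIndices d k, F α / multiFactorial α := by
  induction k generalizing F with
  | zero =>
    have h0 : multiIndices d 0 = {0} := by
      ext α
      rw [mem_multiIndices, Finset.mem_singleton, order, Finset.sum_eq_zero_iff]
      exact ⟨fun h => funext fun i => h i (Finset.mem_univ i), fun h i _ => congrFun h i⟩
    simp [h0, countIndex, multiFactorial]
  | succ k ih =>
    have hj : ∀ j : Fin d, ∑ α ∈ multiIndices d k, F (α + Pi.single j 1) / multiFactorial α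
        = ∑ β ∈ multiIndices d (k + 1), (β j : ℝ) * (F β / multiFactorial β) := fun j => by
      rw [← sum_multiIndices_add_single j fun β h => by simp [h]]
      refine Finset.sum_congr rfl fun α _ => ?_
      have : (multiFactorial α : ℝ) ≠ 0 := by exact_mod_cast (multiFactorial_pos α).ne'
      simp only [multiFactorial_add_single, Pi.add_apply, Pi.single_eq_same]
      push_cast
      field_simp
    rw [sum_fin_cons]
    simp only [countIndex_cons]
    rw [Finset.sum_comm]
    have hi : ∀ j : Fin d, ∑ J : Fin k → Fin d, F (countIndex J + Pi.single j 1)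
        = k.factorial * ∑ β ∈ multiIndices d (k + 1), (β j : ℝ) * (F β / multiFactorial β) :=
      fun j => by rw [← hj]; exact ih fun α => F (α + Pi.single j 1)
    simp only [hi]
    rw [← Finset.mul_sum, Finset.sum_comm, Nat.factorial_succ, Nat.cast_mul,
      mul_comm ((k + 1 : ℕ) : ℝ), mul_assoc]
    congr 1
    rw [Finset.mul_sum]
    refine Finset.sum_congr rfl fun β hβ => ?_
    rw [mem_multiIndices] at hβ
    rw [← Finset.sum_mul, ← hβ, order, Nat.cast_sum]

/-! ### Decay of the Hermite components of a solution -/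

theorem multiFactorial_mul_hermiteCoeff_sq {d : ℕ} (u : WeightedL2 d) (α : Fin d → ℕ) :
    (multiFactorial α : ℝ) * hermiteCoeff u α ^ 2
      = inner ℝ u (hermite α) ^ 2 / multiFactorial α := by
  have : (multiFactorial α : ℝ) ≠ 0 := by exact_mod_cast (multiFactorial_pos α).ne'
  rw [inner_hermite_eq_hermiteCoeff]
  field_simp

/-- The component of a solution in `V_k` decays at least by the factor `‖exp (-tC)‖ ^ k`. -/
theorem IsSolution.sum_hermiteCoeff_sq_le {d : ℕ} {C D : Matrix (Fin d) (Fin d) ℝ}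
    (hD : D = (1 / 2 : ℝ) • (C + C.transpose)) {f₀ : WeightedL2 d} {f : ℝ → WeightedL2 d}
    (hf : IsSolution C D f₀ f) {t : ℝ} (ht : 0 < t) (k : ℕ) :
    ∑ α ∈ multiIndices d k, (multiFactorial α : ℝ) * hermiteCoeff (f t) α ^ 2
      ≤ (‖driftFlow C t‖ ^ 2) ^ k *
        ∑ α ∈ multiIndices d k, (multiFactorial α : ℝ) * hermiteCoeff f₀ α ^ 2 := by
  have h := sum_sq_tensor_le C ht k (fun s I => inner ℝ (f s) (hermite (countIndex I)))
    (fun I => (hf.continuousOn.mono Icc_subset_Ici_self).inner continuousOn_const)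
    (fun s hs I => by
      refine (hf.hasDerivAt_inner_hermite hD (countIndex I) hs.1).congr_deriv (congrArg Neg.neg ?_)
      simp only [countIndex_update]
      exact sum_countIndex_mul I fun i => ∑ j, C i j *
        inner ℝ (f s) (hermite (countIndex I - Pi.single i 1 + Pi.single j 1)))
  simp only [hf.initial] at h
  rw [sum_countIndex k fun α => inner ℝ (f t) (hermite α) ^ 2,
    sum_countIndex k fun α => inner ℝ f₀ (hermite α) ^ 2, mul_left_comm] at h
  simp only [multiFactorial_mul_hermiteCoeff_sq]
  exact le_of_mul_le_mul_left h (by positivity)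

theorem sum_order_mul {d k : ℕ} (F : (Fin d → ℕ) → ℝ) :
    ∑ α ∈ multiIndices d k, (order α : ℝ) * F α = k * ∑ α ∈ multiIndices d k, F α := by
  rw [Finset.mul_sum]
  refine Finset.sum_congr rfl fun α hα => ?_
  rw [mem_multiIndices.1 hα]

theorem IsSolution.summable_order_mul {d : ℕ} {C D : Matrix (Fin d) (Fin d) ℝ}
    (hCD : IsNormalised C D) {f₀ : WeightedL2 d} {f : ℝ → WeightedL2 d}
    (hf : IsSolution C D f₀ f) {t : ℝ} (ht : 0 < t) :
    Summable fun α => (order α : ℝ) * (multiFactorial α * hermiteCoeff (f t) α ^ 2) := by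
  have hq : ‖driftFlow C t‖ ^ 2 < 1 :=
    pow_lt_one₀ (norm_nonneg _) (norm_driftFlow_lt_one hCD ht) two_ne_zero
  have hgeom : Summable fun k : ℕ => (k : ℝ) * (‖driftFlow C t‖ ^ 2) ^ k * ‖f₀‖ ^ 2 := by
    have := summable_pow_mul_geometric_of_norm_lt_one 1
      (r := ‖driftFlow C t‖ ^ 2) (by rwa [Real.norm_of_nonneg (by positivity)])
    simpa only [pow_one] using this.mul_right (‖f₀‖ ^ 2)
  refine summable_of_summable_sum_multiIndices (fun α => by positivity) ?_
  simp only [sum_order_mul]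
  refine Summable.of_nonneg_of_le (fun k => mul_nonneg k.cast_nonneg
    (Finset.sum_nonneg fun α _ => by positivity)) (fun k => ?_) hgeom
  rw [mul_assoc]
  gcongr
  refine (hf.sum_hermiteCoeff_sq_le hCD.eq_symmetric_part ht k).trans ?_
  gcongr
  exact sum_le_hasSum _ (fun α _ => by positivity) (hasSum_hermiteCoeff_sq f₀)

/-- Orthogonality to `V_0, …, V_{m-1}` is preserved by the equation. -/
theorem IsSolution.sum_hermiteCoeff_sq_eq_zero {d : ℕ} {C D : Matrix (Fin d) (Fin d) ℝ}
    (hD : D = (1 / 2 : ℝ) • (C + C.transpose)) {m : ℕ} {f₀ : WeightedL2 d}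
    (hf₀ : f₀ ∈ (⨆ k ∈ Finset.range m, hermiteSpace d k)ᗮ) {f : ℝ → WeightedL2 d}
    (hf : IsSolution C D f₀ f) {t : ℝ} (ht : 0 < t) {k : ℕ} (hk : k < m) :
    ∑ α ∈ multiIndices d k, (multiFactorial α : ℝ) * hermiteCoeff (f t) α ^ 2 = 0 := by
  have h0 : ∑ α ∈ multiIndices d k, (multiFactorial α : ℝ) * hermiteCoeff f₀ α ^ 2 = 0 := by
    refine Finset.sum_eq_zero fun α hα => ?_
    have hmem : hermite α ∈ ⨆ k ∈ Finset.range m, hermiteSpace d k :=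
      Submodule.mem_iSup_of_mem k (Submodule.mem_iSup_of_mem (Finset.mem_range.2 hk)
        (Submodule.subset_span ⟨α, mem_multiIndices.1 hα, rfl⟩))
    rw [multiFactorial_mul_hermiteCoeff_sq, (Submodule.mem_orthogonal' _ f₀).1 hf₀ _ hmem]
    simp
  refine le_antisymm ?_ (Finset.sum_nonneg fun α _ => by positivity)
  simpa [h0] using hf.sum_hermiteCoeff_sq_le hD ht k

end FokkerPlanck

end

theorem theorem2p3 {d : ℕ} (C D : Matrix (Fin d) (Fin d) ℝ) (hCD : FokkerPlanck.IsNormalised C D)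
    (m : ℕ) (f₀ : FokkerPlanck.WeightedL2 d)
    (hf₀ : f₀ ∈ (⨆ k ∈ Finset.range m, FokkerPlanck.hermiteSpace d k)ᗮ)
    (f : ℝ → FokkerPlanck.WeightedL2 d) (hf : FokkerPlanck.IsSolution C D f₀ f)
    (t : ℝ) (ht : 0 < t) :
    HasSum (fun k : ℕ => ∑ α ∈ FokkerPlanck.multiIndices d k,
        FokkerPlanck.hermiteCoeff (f t) α • FokkerPlanck.hermite α) (f t) ∧
      FokkerPlanck.fisherInformation (f t) < ⊤ ∧
      HasSum (fun k : Set.Ici m => ((k : ℕ) : ℝ) * ∑ α ∈ FokkerPlanck.multiIndices d k,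
          (FokkerPlanck.multiFactorial α : ℝ) * FokkerPlanck.hermiteCoeff (f t) α ^ 2)
        (FokkerPlanck.fisherInformation (f t)).toReal := by
  have hsum := hf.summable_order_mul hCD ht
  have hfisher := FokkerPlanck.fisherInformation_eq_tsum (f t) hsum
  refine ⟨FokkerPlanck.hasSum_sum_multiIndices (FokkerPlanck.hasSum_hermiteCoeff (f t)), ?_, ?_⟩
  · rw [hfisher]
    exact ENNReal.ofReal_lt_top
  · rw [hfisher, ENNReal.toReal_ofReal (tsum_nonneg fun α => by positivity)]
    have h := FokkerPlanck.hasSum_sum_multiIndices hsum.hasSum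
    simp only [FokkerPlanck.sum_order_mul] at h
    have hsupp : (Function.support fun k : ℕ => (k : ℝ) * ∑ α ∈ FokkerPlanck.multiIndices d k,
        (FokkerPlanck.multiFactorial α : ℝ) * FokkerPlanck.hermiteCoeff (f t) α ^ 2)
          ⊆ Set.Ici m := by
      intro k hk
      by_contra hlt
      rw [Function.mem_support] at hk
      rw [Set.mem_Ici, not_le] at hlt
      refine hk ?_
      rw [hf.sum_hermiteCoeff_sq_eq_zero hCD.eq_symmetric_part hf₀ ht hlt, mul_zero]
    exact (hasSum_subtype_iff_of_support_subset hsupp).2 h
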